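/- Consider discrete-time load balancing systems with $N\ge 1$ servers, indexed by $\epsilon\in(0,\epsilon_{\max})$ for some $\epsilon_{\max}>0$. In time-slot $t$, $A_\Sigma^{(\epsilon)}(t)$ tasks arrive and server $n$ offers service $S_n(t)$; these are nonnegative-integer-valued, i.i.d. across slots, and independent of each other, with $A_\Sigma^{(\epsilon)}(t)\le A_{\max}$ and $S_n(t)\le S_{\max}$ for constants $A_{\max},S_{\max}$ independent of $\epsilon$, with $\mathbb{P}(A_\Sigma^{(\epsilon)}(t)=0)>0$, with service rates $\mu_n=\mathbb{E}[S_n(t)]>0$, $\mu_\Sigma=\sum_n\mu_n$, and with mean arrival rate $\mathbb{E}[A_\Sigma^{(\epsilon)}(t)]=\mu_\Sigma-\epsilon$. Assume that $\operatorname{Var}(A_\Sigma^{(\epsilon)}(t))\to\sigma_\Sigma^2$ as $\epsilon\downarrow 0$, and put $\zeta=\sigma_\Sigma^2+\sum_n\operatorname{Var}(S_n(t))$. The queue lengths evolve by $Q_n(t+1)=\max\{Q_n(t)+A_n(t)-S_n(t),0\}$, where $A_n(t)$ is the number of tasks routed to server $n$. Under the policy Join-Below-Threshold (JBT) with threshold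 $r\in\mathbb{R}$, all arrivals of a slot are sent to a single server, which is chosen with probability proportional to the service rates $\mu_n$ among the servers with $Q_n(t)<r$ if there are any, and among all servers otherwise. Let $\mathcal{R}^{(r)}=\{x\in\mathbb{R}_+^N: x_n\le r\ \forall n\}\cup\{x\in\mathbb{R}_+^N: x_n\ge r\ \forall n\}$, and let $d_{\mathcal{R}^{(r)}}$ be the Euclidean distance to this set. (a) For every threshold $r$ and every $\epsilon\in(0,\epsilon_{\max})$ the queue length process under JBT has a unique stationary distribution; let $\overline{\mathbf Q}^{(\epsilon)}$ denote a random vector with this distribution. For thresholds $r^{(\epsilon)}$, say that the state space collapses with exponent $\theta^*>0$ if there are $\epsilon_0,C^*>0$ with $\mathbb{E}\big[e^{\theta^* d_{\mathcal{R}^{(r^{(\epsilon)})}}(\overline{\mathbf Q}^{(\epsilon)})}\big]\le C^*$ for all $\epsilon\in(0,\epsilon_{\max})$ with $\epsilon<\epsilon_0$. (b) There is a $\theta^*>0$, not depending on the choice of the thresholds, such that for all thresholds with $\lim_{\epsilon\downarrow0}r^{(\epsilon)}=\infty$ the state space collapses with exponent $\theta^*$. (c) Let $\alpha>0$, and let the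 thresholds $r^{(\epsilon)}$ and $\theta^*>0$ be such that the state space collapses with exponent $\theta^*$. Suppose that $r^{(\epsilon)}\ge K\log(1/\epsilon)$ for all sufficiently small $\epsilon>0$, where $K=2(1+\alpha)/\theta^*$, and that $r^{(\epsilon)}=o(1/\epsilon)$ as $\epsilon\downarrow0$. Then JBT is heavy-traffic delay optimal in steady state: $$\limsup_{\epsilon\downarrow0}\ \epsilon\,\mathbb{E}\Big[\sum_{n=1}^N\overline{Q}_n^{(\epsilon)}\Big]\le\frac{\zeta}{2}.$$ -/

import Mathlib

open Filter Topology MeasureTheory ProbabilityTheory Asymptotics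
open scoped ENNReal

noncomputable section

namespace JBT

/-- The law of a vector of independent `ℕ`-valued random variables with laws `p i`. -/
def indepPMF {N : ℕ} (p : Fin N → PMF ℕ) : PMF (Fin N → ℕ) :=
  ⟨fun s => ∏ i, p i (s i), by
    have h : ∑' s : Fin N → ℕ, ∏ i, p i (s i) = 1 := by
      have h1 := measure_univ (μ := Measure.pi fun i => (p i).toMeasure)
      rw [← Measure.tsum_indicator_apply_singleton _ _ MeasurableSet.univ] at h1
      simpa [Measure.pi_singleton, PMF.toMeasure_apply_singleton] using h1
    exact h ▸ ENNReal.summable.hasSum⟩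

/-- Mean of an `ℕ`-valued random variable with law `p`. -/
def mean (p : PMF ℕ) : ℝ := ∫ k, (k : ℝ) ∂p.toMeasure

/-- Variance of an `ℕ`-valued random variable with law `p`. -/
def var (p : PMF ℕ) : ℝ := Var[fun k : ℕ => (k : ℝ); p.toMeasure]

/-- The primitives of a family, indexed by the heavy-traffic parameter `ε ∈ (0, εmax)`, of
discrete-time load balancing systems with `N` servers. In every slot the number of exogenous
arrivals has law `arrival ε`, the service offered by server `n` has law `service n`; all of these
are independent of each other and across slots. -/
structure System (N : ℕ) where
  service : Fin N → PMF ℕ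
  arrival : ℝ → PMF ℕ
  εmax : ℝ
  Amax : ℕ
  Smax : ℕ
  εmax_pos : 0 < εmax
  service_le : ∀ n, ∀ k ∈ (service n).support, k ≤ Smax
  service_mean_pos : ∀ n, 0 < mean (service n)
  arrival_le : ∀ ε ∈ Set.Ioo 0 εmax, ∀ k ∈ (arrival ε).support, k ≤ Amax
  arrival_zero : ∀ ε ∈ Set.Ioo 0 εmax, 0 < arrival ε 0
  arrival_mean : ∀ ε ∈ Set.Ioo 0 εmax, mean (arrival ε) = ∑ n, mean (service n) - ε

/-- The servers whose queue length is below the threshold `r`: these are the IDs in the memory of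
the dispatcher at the beginning of a slot. (A server that is below the threshold and whose ID is
not in memory reports its ID. An ID leaves the memory only when tasks are sent to its server, and
it is reported again if the queue length is still below the threshold after the slot.) -/
def memory {N : ℕ} (r : ℝ) (q : Fin N → ℕ) : Finset (Fin N) :=
  Finset.univ.filter fun n => (q n : ℝ) < r

open Classical in
/-- The servers among which the dispatcher chooses: those in memory if there are any, and all
servers otherwise. -/
def candidates {N : ℕ} (r : ℝ) (q : Fin N → ℕ) : Finset (Fin N) :=
  if (memory r q).Nonempty then memory r q else Finset.univ

theorem candidates_nonempty {N : ℕ} [NeZero N] (r : ℝ) (q : Fin N → ℕ) :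
    (candidates r q).Nonempty := by
  unfold candidates
  split_ifs with h
  · exact h
  · exact Finset.univ_nonempty

namespace System

variable {N : ℕ}

/-- Service rate of server `n`. -/
def rate (M : System N) (n : Fin N) : ℝ := mean (M.service n)

/-- The routing decision of JBT with threshold `r` at queue lengths `q`: server `i` is chosen among
the candidates with probability proportional to its service rate (hence uniformly, if the service
rates are equal). -/
def dispatch [NeZero N] (M : System N) (r : ℝ) (q : Fin N → ℕ) : PMF (Fin N) :=
  PMF.ofFinset
    (fun i => if i ∈ candidates r q then
      ENNReal.ofReal (M.rate i / ∑ j ∈ candidates r q, M.rate j) else 0)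
    (candidates r q)
    (by
      have hpos : 0 < ∑ j ∈ candidates r q, M.rate j :=
        Finset.sum_pos (fun j _ => M.service_mean_pos j) (candidates_nonempty r q)
      rw [Finset.sum_congr rfl fun i hi => if_pos hi, ← ENNReal.ofReal_sum_of_nonneg
        fun i _ => div_nonneg (show 0 ≤ M.rate i from (M.service_mean_pos i).le) hpos.le, ← Finset.sum_div,
        div_self hpos.ne', ENNReal.ofReal_one])
    (fun i hi => if_neg hi)

/-- Queue lengths after a slot that starts in state `q`, in which all `a` arrivals are routed to
server `i` and the offered service is `s`. Subtraction in `ℕ` is truncated at zero. -/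
def next (q : Fin N → ℕ) (i : Fin N) (a : ℕ) (s : Fin N → ℕ) : Fin N → ℕ :=
  fun n => q n + (if n = i then a else 0) - s n

/-- The queue dynamics `Q(t+1) = Q(t) + A(t) - S(t) + U(t)`, where the unused service is
`U(t) = max (S(t) - Q(t) - A(t)) 0`. -/
theorem next_eq (q : Fin N → ℕ) (i : Fin N) (a : ℕ) (s : Fin N → ℕ) (n : Fin N) :
    (next q i a s n : ℤ) = q n + (if n = i then (a : ℤ) else 0) - s n +
      max ((s n : ℤ) - q n - (if n = i then (a : ℤ) else 0)) 0 := by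
  unfold next
  split_ifs <;> omega

/-- One-step transition law of the queue length process under JBT with threshold `r` in the
system with parameter `ε`. -/
def step [NeZero N] (M : System N) (ε r : ℝ) (q : Fin N → ℕ) : PMF (Fin N → ℕ) :=
  (M.dispatch r q).bind fun i =>
    (M.arrival ε).bind fun a =>
      (indepPMF M.service).map fun s => next q i a s

/-- `π` is a stationary distribution of the queue length chain under JBT with threshold `r` in the
system with parameter `ε`. -/
def IsStationary [NeZero N] (M : System N) (ε r : ℝ) (π : PMF (Fin N → ℕ)) : Prop :=
  π.bind (M.step ε r) = π

end System

/-- The part of the nonnegative orthant where every coordinate is at most `r`. -/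
def lowerRegion (N : ℕ) (r : ℝ) : Set (EuclideanSpace ℝ (Fin N)) :=
  {x | (∀ n, 0 ≤ x n) ∧ ∀ n, x n ≤ r}

/-- The part of the nonnegative orthant where every coordinate is at least `r`. -/
def upperRegion (N : ℕ) (r : ℝ) : Set (EuclideanSpace ℝ (Fin N)) :=
  {x | (∀ n, 0 ≤ x n) ∧ ∀ n, r ≤ x n}

def region (N : ℕ) (r : ℝ) : Set (EuclideanSpace ℝ (Fin N)) :=
  lowerRegion N r ∪ upperRegion N r

/-- Euclidean distance of a vector of queue lengths to the region. -/
def distRegion {N : ℕ} (r : ℝ) (q : Fin N → ℕ) : ℝ :=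
  Metric.infDist (WithLp.toLp 2 fun n => (q n : ℝ)) (region N r)

/-- Expectation of a nonnegative function of a random variable with law `π`. -/
def expect {X : Type*} (π : PMF X) (f : X → ℝ≥0∞) : ℝ≥0∞ := ∑' x, π x * f x

namespace System

variable {N : ℕ}

/-- State-space collapse to the region with exponent `θ`, under JBT with thresholds `r ε`. -/
def CollapsesWith [NeZero N] (M : System N) (r : ℝ → ℝ) (θ : ℝ) : Prop :=
  ∃ ε₀ > 0, ∃ C > 0, ∀ ε ∈ Set.Ioo 0 M.εmax, ε < ε₀ →
    ∀ π, M.IsStationary ε (r ε) π →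
      expect π (fun q => ENNReal.ofReal (Real.exp (θ * distRegion (r ε) q))) ≤ ENNReal.ofReal C

/-- Steady-state heavy-traffic delay optimality of JBT with thresholds `r ε`, where `σsq` is the
limit of the variance of the arrivals: the systems have a unique stationary distribution, and the
scaled expected total queue length is asymptotically at most `ζ / 2`. -/
def HeavyTrafficDelayOptimal [NeZero N] (M : System N) (σsq : ℝ) (r : ℝ → ℝ) : Prop :=
  (∀ ε ∈ Set.Ioo 0 M.εmax, ∃! π, M.IsStationary ε (r ε) π) ∧
  ∀ π : ℝ → PMF (Fin N → ℕ), (∀ ε ∈ Set.Ioo 0 M.εmax, M.IsStationary ε (r ε) (π ε)) →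
    limsup (fun ε => ENNReal.ofReal ε * expect (π ε) (fun q => ∑ n, (q n : ℝ≥0∞))) (𝓝[>] 0)
      ≤ ENNReal.ofReal ((σsq + ∑ n, var (M.service n)) / 2)

end System

end JBT

end

/-!
The stationary distribution is studied through Lyapunov functions. The basic tool is the comparison
theorem `expect_le_of_drift`: if `E[V(Q⁺) | Q] + f(Q) ≤ V(Q) + g(Q)`, then `E f ≤ E g` in steady
state, for `V`, `f`, `g` nonnegative and with no integrability of `V` assumed.

*Stability.* The function `∑ q n ^ 3` has drift at most `-c ε ∑ q n ^ 2 + K` (`cubic_drift`): below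
the threshold the contribution of the arrivals is bounded, and if no server is below the threshold
then every server receives a share of the load proportional to its rate. Existence follows from
Krylov–Bogoliubov (`exists_invariant`), and uniqueness because the empty state can be reached from
every state (`invariant_unique`). The same drift inequality bounds the stationary second moment by
a multiple of `1 / ε ^ 2 + r ^ 2 / ε + 1 / ε`.

*State space collapse.* For `r ≥ 0` the distance to the region is the smaller of the norms of
`(q - r)⁺` and `(r - q)⁺`. Off the region some server is below and some server is above the
threshold. The servers above receive nothing, so that they drain; the servers below share an arrival
rate that exceeds their joint service rate, so that they fill up. Both norms thus have a drift
bounded away from zero, uniformly in `ε` and `r`, and since the increments are bounded,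
`exp (θ d)` has geometric drift (`exp_distRegion_drift`).

*Heavy-traffic limit.* Let `T` be the total queue length and `U` the total unused service of a slot.
The drift of `T ^ 2` gives `2 ε E T ≤ E (A - ∑ S) ^ 2 + 2 E (T⁺ U)`, where `E U = ε` by the drift of
`T`, `T⁺` is the total queue length after the slot, and the first term tends to `ζ`. When service is unused some queue is empty after the slot; so
either `T⁺ ≤ N (r + d)`, which contributes `N r ε` and a term of order `√ε`, or `d ≥ r`
(`total_le_of_eq_zero`). The latter event has probability of order `exp (-θ r)`, and the threshold
is large enough for this to beat the second moment of `T`.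
-/

namespace JBT

/-! ### Markov chains on a discrete state space -/

section Chain

variable {X Y : Type*}

theorem expect_bind (π : PMF X) (κ : X → PMF Y) (f : Y → ℝ≥0∞) :
    expect (π.bind κ) f = expect π fun x => expect (κ x) f := by
  simp only [expect, PMF.bind_apply, ← ENNReal.tsum_mul_right, ← ENNReal.tsum_mul_left]
  rw [ENNReal.tsum_comm]
  simp only [mul_assoc]

theorem expect_mono (π : PMF X) {f g : X → ℝ≥0∞} (h : ∀ x, f x ≤ g x) :
    expect π f ≤ expect π g :=
  ENNReal.tsum_le_tsum fun x => by gcongr; exact h x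

theorem expect_add (π : PMF X) (f g : X → ℝ≥0∞) :
    expect π (fun x => f x + g x) = expect π f + expect π g := by
  simp only [expect, mul_add, ENNReal.tsum_add]

theorem expect_const_mul (π : PMF X) (c : ℝ≥0∞) (f : X → ℝ≥0∞) :
    expect π (fun x => c * f x) = c * expect π f := by
  simp only [expect, ← ENNReal.tsum_mul_left]
  exact tsum_congr fun x => by ring

theorem expect_const (π : PMF X) (c : ℝ≥0∞) : expect π (fun _ => c) = c := by
  simp [expect, ENNReal.tsum_mul_right]

theorem expect_of_invariant {π : PMF X} {κ : X → PMF X} (h : π.bind κ = π) (f : X → ℝ≥0∞) :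
    expect π (fun x => expect (κ x) f) = expect π f := by
  rw [← expect_bind, h]

/-- The comparison theorem for stationary distributions. No integrability of the Lyapunov
function `V` is needed. -/
theorem expect_le_of_drift {π : PMF X} {κ : X → PMF X} (h : π.bind κ = π)
    {V f g : X → ℝ≥0∞} (hV : ∀ x, V x ≠ ∞)
    (hd : ∀ x, expect (κ x) V + f x ≤ V x + g x) : expect π f ≤ expect π g := by
  classical
  have key : ∀ m : ℕ, expect π (fun x => if V x ≤ m then f x else 0) ≤ expect π g := by
    intro m
    -- The truncation `min V m` inherits the drift inequality and has finite mean, which cancels.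
    have hm : ∀ x, expect (κ x) (fun y => min (V y) m) + (if V x ≤ m then f x else 0)
        ≤ min (V x) m + g x := by
      intro x
      split_ifs with hx
      · rw [min_eq_left hx]
        exact (add_le_add_left (expect_mono _ fun y => min_le_left _ _) _).trans (hd x)
      · rw [min_eq_right (not_le.1 hx).le, add_zero]
        calc _ ≤ expect (κ x) (fun _ => (m : ℝ≥0∞)) := expect_mono _ fun y => min_le_right _ _
          _ = m := expect_const _ _
          _ ≤ _ := le_self_add
    have h1 := expect_mono π hm
    rw [expect_add, expect_add, expect_of_invariant h] at h1
    refine (ENNReal.add_le_add_iff_left (ne_top_of_le_ne_top (ENNReal.natCast_ne_top m) ?_)).1 h1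
    exact (expect_mono π fun y => min_le_right _ _).trans (expect_const _ _).le
  refine ENNReal.summable.tsum_le_of_sum_le fun F => ?_
  obtain ⟨m, hm⟩ : ∃ m : ℕ, ∀ x ∈ F, V x ≤ m := by
    have : ∀ x, ∃ m : ℕ, V x ≤ m := fun x => (ENNReal.exists_nat_gt (hV x)).imp fun _ => le_of_lt
    choose m hm using this
    exact ⟨F.sup m, fun x hx => (hm x).trans (by exact_mod_cast Finset.le_sup (f := m) hx)⟩
  calc ∑ x ∈ F, π x * f x = ∑ x ∈ F, π x * (if V x ≤ m then f x else 0) :=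
        Finset.sum_congr rfl fun x hx => by rw [if_pos (hm x hx)]
    _ ≤ _ := ENNReal.sum_le_tsum F
    _ ≤ _ := key m

/-- If every state can reach `x₀` along transitions that decrease a rank, then every nonzero
invariant measure charges `x₀`. -/
theorem invariant_pos {κ : X → PMF X} {x₀ : X} (rk : X → ℕ)
    (hr : ∀ x, x ≠ x₀ → ∃ y, rk y < rk x ∧ κ x y ≠ 0) {η : X → ℝ≥0∞}
    (hη : ∀ y, ∑' x, η x * κ x y = η y) {x : X} (hx : η x ≠ 0) : η x₀ ≠ 0 := by
  induction hn : rk x using Nat.strong_induction_on generalizing x with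
  | _ n ih =>
    by_cases hx0 : x = x₀
    · exact hx0 ▸ hx
    obtain ⟨y, hy, hxy⟩ := hr x hx0
    refine ih (rk y) (hn ▸ hy) (x := y) (fun h0 => ?_) rfl
    have := (hη y).trans h0
    rw [ENNReal.tsum_eq_zero] at this
    exact mul_ne_zero hx hxy (this x)

theorem eq_of_tsum_eq {f g : X → ℝ≥0∞} (hle : ∀ x, f x ≤ g x) (hfin : ∑' x, f x ≠ ∞)
    (h : ∑' x, g x ≤ ∑' x, f x) : f = g := by
  funext x
  by_contra hne
  exact absurd h (not_le.2 (ENNReal.tsum_lt_tsum hfin hle (lt_of_le_of_ne (hle x) hne)))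

/-- Uniqueness of the stationary distribution. The minimum of two stationary distributions is
invariant, and the two remainders are invariant with disjoint supports; they would both charge `x₀`
if they were nonzero. -/
theorem invariant_unique {κ : X → PMF X} {x₀ : X} (rk : X → ℕ)
    (hr : ∀ x, x ≠ x₀ → ∃ y, rk y < rk x ∧ κ x y ≠ 0) {π₁ π₂ : PMF X}
    (h₁ : π₁.bind κ = π₁) (h₂ : π₂.bind κ = π₂) : π₁ = π₂ := by
  have e₁ : ∀ y, ∑' x, π₁ x * κ x y = π₁ y := fun y => by rw [← PMF.bind_apply, h₁]
  have e₂ : ∀ y, ∑' x, π₂ x * κ x y = π₂ y := fun y => by rw [← PMF.bind_apply, h₂]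
  set m : X → ℝ≥0∞ := fun x => min (π₁ x) (π₂ x) with hm
  have mle₁ : ∀ x, m x ≤ π₁ x := fun x => min_le_left _ _
  have mle₂ : ∀ x, m x ≤ π₂ x := fun x => min_le_right _ _
  have mtop : ∀ x, m x ≠ ∞ := fun x => ne_top_of_le_ne_top (π₁.apply_ne_top x) (mle₁ x)
  have msum : ∑' x, m x ≠ ∞ := ne_top_of_le_ne_top π₁.tsum_coe_ne_top (ENNReal.tsum_le_tsum mle₁)
  have mass : ∑' y, ∑' x, m x * κ x y = ∑' x, m x := by
    rw [ENNReal.tsum_comm]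
    simp [ENNReal.tsum_mul_left]
  have em : ∀ y, ∑' x, m x * κ x y = m y := by
    refine fun y => congrFun (eq_of_tsum_eq (fun y => le_min ?_ ?_) ?_ mass.ge) y
    · exact (ENNReal.tsum_le_tsum fun x => by gcongr; exact mle₁ x).trans (e₁ y).le
    · exact (ENNReal.tsum_le_tsum fun x => by gcongr; exact mle₂ x).trans (e₂ y).le
    · rwa [mass]
  have rem : ∀ π : PMF X, (∀ y, ∑' x, π x * κ x y = π y) → (∀ x, m x ≤ π x) →
      (∀ x, π x = m x) ∨ π x₀ - m x₀ ≠ 0 := by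
    intro π e hle
    by_cases hz : ∀ x, π x = m x
    · exact Or.inl hz
    · right
      push Not at hz
      obtain ⟨x, hx⟩ := hz
      refine invariant_pos rk hr (η := fun x => π x - m x) (fun y => ?_) (x := x) ?_
      · have : ∑' x, (π x - m x) * κ x y + m y = π y := by
          rw [← em y, ← ENNReal.tsum_add, ← e y]
          exact tsum_congr fun x => by rw [← add_mul, tsub_add_cancel_of_le (hle x)]
        rw [← this, ENNReal.add_sub_cancel_right (mtop y)]
      · exact (tsub_pos_of_lt (lt_of_le_of_ne (hle x) (Ne.symm hx))).ne'
  have eqs : ∀ π π' : PMF X, (∀ x, m x ≤ π' x) → (∀ x, π x = m x) → π = π' := fun π π' hle h =>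
    PMF.ext fun x => congrFun (eq_of_tsum_eq (fun x => (h x).le.trans (hle x)) π.tsum_coe_ne_top
      (by rw [π.tsum_coe, π'.tsum_coe])) x
  rcases rem π₁ e₁ mle₁ with h | h
  · exact eqs π₁ π₂ mle₂ h
  rcases rem π₂ e₂ mle₂ with h' | h'
  · exact (eqs π₂ π₁ mle₁ h').symm
  · exfalso
    rcases le_total (π₁ x₀) (π₂ x₀) with hh | hh
    · exact h (by simp [hm, hh])
    · exact h' (by simp [hm, hh])

/-- The law at time `t` of the chain with kernel `κ` started in `x₀`. -/
noncomputable def iterLaw (κ : X → PMF X) (x₀ : X) : ℕ → PMF X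
  | 0 => PMF.pure x₀
  | t + 1 => (iterLaw κ x₀ t).bind κ

/-- The average of the laws of the chain over the first `T` slots. -/
noncomputable def cesaro (κ : X → PMF X) (x₀ : X) (T : ℕ) (x : X) : ℝ≥0∞ :=
  (T : ℝ≥0∞)⁻¹ * ∑ t ∈ Finset.range T, iterLaw κ x₀ t x

theorem tsum_cesaro_mul (κ : X → PMF X) (x₀ : X) (T : ℕ) (f : X → ℝ≥0∞) :
    ∑' x, cesaro κ x₀ T x * f x =
      (T : ℝ≥0∞)⁻¹ * ∑ t ∈ Finset.range T, expect (iterLaw κ x₀ t) f := by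
  simp only [cesaro, expect, mul_assoc, Finset.sum_mul, ENNReal.tsum_mul_left]
  rw [Summable.tsum_finsetSum fun _ _ => ENNReal.summable]

theorem tsum_cesaro (κ : X → PMF X) (x₀ : X) {T : ℕ} (hT : T ≠ 0) :
    ∑' x, cesaro κ x₀ T x = 1 := by
  have := tsum_cesaro_mul κ x₀ T (fun _ => 1)
  simp only [expect_const, mul_one, Finset.sum_const, Finset.card_range, nsmul_eq_mul] at this
  rw [this, ENNReal.inv_mul_cancel (by exact_mod_cast hT) (ENNReal.natCast_ne_top T)]

theorem cesaro_step_le (κ : X → PMF X) (x₀ : X) (T : ℕ) (y : X) :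
    ∑' x, cesaro κ x₀ T x * κ x y ≤ cesaro κ x₀ T y + (T : ℝ≥0∞)⁻¹ := by
  rw [tsum_cesaro_mul, cesaro]
  nth_rw 3 [← mul_one (T : ℝ≥0∞)⁻¹]
  rw [← mul_add]
  gcongr
  have : ∀ t, expect (iterLaw κ x₀ t) (fun x => κ x y) = iterLaw κ x₀ (t + 1) y := fun t => by
    rw [iterLaw, PMF.bind_apply, expect]
  simp only [this]
  calc _ ≤ ∑ t ∈ Finset.range (T + 1), iterLaw κ x₀ t y := by
        rw [Finset.sum_range_succ']; exact le_self_add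
    _ ≤ _ := by rw [Finset.sum_range_succ]; gcongr; exact PMF.coe_le_one _ _

theorem cesaro_drift_le {κ : X → PMF X} {x₀ : X} {V f : X → ℝ≥0∞} {K : ℝ≥0∞}
    (hV₀ : V x₀ = 0) (hd : ∀ x, expect (κ x) V + f x ≤ V x + K) {T : ℕ} (hT : T ≠ 0) :
    ∑' x, cesaro κ x₀ T x * f x ≤ K := by
  have hsum : ∀ T : ℕ, expect (iterLaw κ x₀ T) V +
      ∑ t ∈ Finset.range T, expect (iterLaw κ x₀ t) f ≤ T * K := by
    intro T
    induction T with
    | zero =>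
      simp only [iterLaw, Finset.range_zero, Finset.sum_empty, Nat.cast_zero, zero_mul, add_zero,
        nonpos_iff_eq_zero]
      simp only [expect, PMF.pure_apply, ENNReal.tsum_eq_zero]
      intro x
      by_cases hx : x = x₀ <;> simp [hx, hV₀]
    | succ T ih =>
      have h1 := expect_mono (iterLaw κ x₀ T) hd
      rw [expect_add, expect_add, expect_const, ← expect_bind] at h1
      rw [Finset.sum_range_succ, iterLaw]
      calc _ = (expect ((iterLaw κ x₀ T).bind κ) V + expect (iterLaw κ x₀ T) f) +
            ∑ t ∈ Finset.range T, expect (iterLaw κ x₀ t) f := by ring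
        _ ≤ (expect (iterLaw κ x₀ T) V + K) +
            ∑ t ∈ Finset.range T, expect (iterLaw κ x₀ t) f := by gcongr
        _ = (expect (iterLaw κ x₀ T) V +
            ∑ t ∈ Finset.range T, expect (iterLaw κ x₀ t) f) + K := by ring
        _ ≤ T * K + K := by gcongr
        _ = _ := by push_cast; ring
  rw [tsum_cesaro_mul]
  calc _ ≤ (T : ℝ≥0∞)⁻¹ * (T * K) := by gcongr; exact le_add_self.trans (hsum T)
    _ = K := by
      rw [← mul_assoc, ENNReal.inv_mul_cancel (by exact_mod_cast hT) (ENNReal.natCast_ne_top T),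
        one_mul]

/-- Existence of a stationary distribution under a Foster–Lyapunov condition in which the drift
function `f` has finite sublevel sets (Krylov–Bogoliubov). -/
theorem exists_invariant {κ : X → PMF X} {x₀ : X} {V f : X → ℝ≥0∞} {K : ℝ≥0∞} (hK : K ≠ ∞)
    (hV₀ : V x₀ = 0) (hd : ∀ x, expect (κ x) V + f x ≤ V x + K)
    (hf : ∀ m : ℕ, {x | f x ≤ m}.Finite) : ∃ π : PMF X, π.bind κ = π := by
  -- Limits are taken along a free ultrafilter, which avoids extracting a convergent subsequence.
  have hlim : ∀ x, ∃ l, Tendsto (fun T => cesaro κ x₀ T x) (hyperfilter ℕ : Filter ℕ) (𝓝 l) := by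
    intro x
    obtain ⟨l, -, hl⟩ := isCompact_univ.ultrafilter_le_nhds
      ((hyperfilter ℕ).map fun T => cesaro κ x₀ T x) (by simp)
    exact ⟨l, hl⟩
  choose p hp using hlim
  have hle : (hyperfilter ℕ : Filter ℕ) ≤ atTop := Nat.hyperfilter_le_atTop
  have hne : ∀ᶠ T : ℕ in (hyperfilter ℕ : Filter ℕ), T ≠ 0 := hle (eventually_ne_atTop 0)
  have hsumF : ∀ F : Finset X, Tendsto (fun T => ∑ x ∈ F, cesaro κ x₀ T x)
      (hyperfilter ℕ : Filter ℕ) (𝓝 (∑ x ∈ F, p x)) := fun F => tendsto_finsetSum _ fun x _ => hp x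
  have hp1 : ∑' x, p x ≤ 1 := by
    refine ENNReal.summable.tsum_le_of_sum_le fun F => le_of_tendsto (hsumF F) ?_
    filter_upwards [hne] with T hT
    exact (ENNReal.sum_le_tsum F).trans (tsum_cesaro κ x₀ hT).le
  have htight : ∀ m : ℕ, m ≠ 0 → 1 ≤ ∑' x, p x + K / m := by
    intro m hm
    have hm0 : (m : ℝ≥0∞) ≠ 0 := by exact_mod_cast hm
    refine le_trans ?_ (add_le_add_left (ENNReal.sum_le_tsum (hf m).toFinset) _)
    refine ge_of_tendsto ((hsumF (hf m).toFinset).add_const _) ?_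
    filter_upwards [hne] with T hT
    rw [← tsum_cesaro κ x₀ hT, sum_eq_tsum_indicator]
    have h2 : ∑' x, (m : ℝ≥0∞)⁻¹ * (cesaro κ x₀ T x * f x) ≤ K / m := by
      rw [ENNReal.tsum_mul_left, mul_comm, ← div_eq_mul_inv]
      exact ENNReal.div_le_div_right (cesaro_drift_le hV₀ hd hT) _
    refine le_trans ?_ (add_le_add_right h2 _)
    rw [← ENNReal.tsum_add]
    refine ENNReal.tsum_le_tsum fun x => ?_
    by_cases hx : x ∈ ((hf m).toFinset : Set X)
    · rw [Set.indicator_of_mem hx]; exact le_self_add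
    · rw [Set.indicator_of_notMem hx, zero_add]
      have hx' : (m : ℝ≥0∞) ≤ f x := by
        simp only [Set.Finite.coe_toFinset, Set.mem_ofPred_eq, not_le] at hx
        exact hx.le
      calc cesaro κ x₀ T x = (m : ℝ≥0∞)⁻¹ * (cesaro κ x₀ T x * m) := by
            rw [mul_comm (cesaro κ x₀ T x), ← mul_assoc,
              ENNReal.inv_mul_cancel hm0 (ENNReal.natCast_ne_top m), one_mul]
        _ ≤ _ := by gcongr
  have hp2 : 1 ≤ ∑' x, p x := by
    have h0 : Tendsto (fun m : ℕ => ∑' x, p x + K / m) atTop (𝓝 (∑' x, p x + 0)) := by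
      refine tendsto_const_nhds.add ?_
      simpa [div_eq_mul_inv] using
        ENNReal.Tendsto.const_mul ENNReal.tendsto_inv_nat_nhds_zero (Or.inr hK)
    rw [add_zero] at h0
    exact ge_of_tendsto h0 ((eventually_ne_atTop 0).mono htight)
  have hps : ∑' x, p x = 1 := le_antisymm hp1 hp2
  have hinv : ∀ y, ∑' x, p x * κ x y ≤ p y := by
    intro y
    refine ENNReal.summable.tsum_le_of_sum_le fun F => ?_
    have hr : Tendsto (fun T : ℕ => cesaro κ x₀ T y + (T : ℝ≥0∞)⁻¹) (hyperfilter ℕ : Filter ℕ)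
        (𝓝 (p y + 0)) := (hp y).add (ENNReal.tendsto_inv_nat_nhds_zero.mono_left hle)
    rw [add_zero] at hr
    refine le_of_tendsto_of_tendsto' (tendsto_finsetSum F fun x _ =>
      ENNReal.Tendsto.mul_const (hp x) (Or.inr ((κ x).apply_ne_top y))) hr fun T => ?_
    exact (ENNReal.sum_le_tsum F).trans (cesaro_step_le κ x₀ T y)
  have hmass : ∑' y, ∑' x, p x * κ x y = 1 := by
    rw [ENNReal.tsum_comm]
    simp [ENNReal.tsum_mul_left, hps]
  obtain ⟨π, hπ⟩ : ∃ π : PMF X, ∀ x, π x = p x :=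
    ⟨⟨p, hps ▸ ENNReal.summable.hasSum⟩, fun _ => rfl⟩
  refine ⟨π, PMF.ext fun y => ?_⟩
  simp only [PMF.bind_apply, hπ]
  exact congrFun (eq_of_tsum_eq hinv (by simp [hmass]) (by rw [hmass, hps])) y

end Chain

/-! ### Means over one slot -/

theorem lintegral_toMeasure {X : Type*} [Countable X] [MeasurableSpace X]
    [MeasurableSingletonClass X] (p : PMF X) (f : X → ℝ≥0∞) :
    ∫⁻ x, f x ∂p.toMeasure = expect p f := by
  rw [lintegral_countable']
  simp only [expect, PMF.toMeasure_apply_singleton _ _ (measurableSet_singleton _), mul_comm]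

theorem indepPMF_toMeasure {N : ℕ} (p : Fin N → PMF ℕ) :
    (indepPMF p).toMeasure = Measure.pi fun n => (p n).toMeasure := by
  refine Measure.ext_of_singleton fun s => ?_
  rw [PMF.toMeasure_apply_singleton _ _ (measurableSet_singleton _), Measure.pi_singleton]
  simp only [PMF.toMeasure_apply_singleton _ _ (measurableSet_singleton _)]
  rfl

theorem memLp_of_finite {X : Type*} [Countable X] [MeasurableSpace X]
    [MeasurableSingletonClass X] {μ : Measure X} [IsFiniteMeasure μ] {F : Set X} (hF : F.Finite)
    (h : ∀ᵐ x ∂μ, x ∈ F) (f : X → ℝ) (p : ℝ≥0∞) : MemLp f p μ := by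
  obtain ⟨C, hC⟩ := (hF.image fun x => ‖f x‖).bddAbove
  refine MemLp.of_bound (Measurable.of_discrete).aestronglyMeasurable C ?_
  filter_upwards [h] with x hx using hC ⟨x, hx, rfl⟩

theorem ae_le_of_support {p : PMF ℕ} {B : ℕ} (h : ∀ k ∈ p.support, k ≤ B) :
    ∀ᵐ k ∂p.toMeasure, k ≤ B := by
  rw [ae_iff, PMF.toMeasure_apply_eq_zero_iff _ (MeasurableSet.of_discrete),
    Set.disjoint_left]
  exact fun k hk hk' => hk' (h k hk)

namespace System

variable {N : ℕ} [NeZero N] (M : System N)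

/-- The outcome space of one slot: the chosen server, the number of arrivals, and the offered
services. -/
abbrev Outcome (N : ℕ) := Fin N × ℕ × (Fin N → ℕ)

/-- The joint law of the outcomes of a slot that starts in state `q`. -/
noncomputable def noise (ε r : ℝ) (q : Fin N → ℕ) : Measure (Outcome N) :=
  (M.dispatch r q).toMeasure.prod
    ((M.arrival ε).toMeasure.prod (Measure.pi fun n => (M.service n).toMeasure))

instance (ε r : ℝ) (q : Fin N → ℕ) : IsProbabilityMeasure (M.noise ε r q) := by
  unfold noise; infer_instance

/-- The state after a slot with outcome `ω`. -/
def after {N : ℕ} (q : Fin N → ℕ) (ω : Outcome N) : Fin N → ℕ := next q ω.1 ω.2.1 ω.2.2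

/-- Arrivals minus offered service at server `n`. -/
def netInput {N : ℕ} (ω : Outcome N) (n : Fin N) : ℝ :=
  (if n = ω.1 then (ω.2.1 : ℝ) else 0) - ω.2.2 n

theorem after_apply {N : ℕ} (q : Fin N → ℕ) (ω : Outcome N) (n : Fin N) :
    (after q ω n : ℝ) = max (q n + netInput ω n) 0 := by
  have h := next_eq q ω.1 ω.2.1 ω.2.2 n
  have h' : (after q ω n : ℝ) = (q n : ℝ) + (if n = ω.1 then (ω.2.1 : ℝ) else 0) - ω.2.2 n +
      max ((ω.2.2 n : ℝ) - q n - (if n = ω.1 then (ω.2.1 : ℝ) else 0)) 0 := by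
    have := congrArg (Int.cast (R := ℝ)) h
    push_cast at this
    exact this
  rw [h', netInput]
  rcases le_total ((ω.2.2 n : ℝ) - q n - (if n = ω.1 then (ω.2.1 : ℝ) else 0)) 0 with h0 | h0
  · rw [max_eq_right h0, max_eq_left (by linarith)]; ring
  · rw [max_eq_left h0, max_eq_right (by linarith)]; ring

theorem expect_step (ε r : ℝ) (q : Fin N → ℕ) (F : (Fin N → ℕ) → ℝ≥0∞) :
    expect (M.step ε r q) F = ∫⁻ ω, F (after q ω) ∂M.noise ε r q := by
  have hmap : ∀ (i : Fin N) (a : ℕ), expect ((indepPMF M.service).map fun s => next q i a s) F =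
      ∫⁻ s, F (next q i a s) ∂(Measure.pi fun n => (M.service n).toMeasure) := by
    intro i a
    rw [PMF.map, expect_bind, ← indepPMF_toMeasure, lintegral_toMeasure]
    congr 1
    funext s
    simp only [expect, Function.comp_apply, PMF.pure_apply]
    rw [tsum_eq_single (next q i a s) fun x hx => by simp [hx]]
    simp
  rw [noise, lintegral_prod _ (Measurable.of_discrete).aemeasurable, step, expect_bind,
    lintegral_toMeasure]
  congr 1
  funext i
  rw [lintegral_prod _ (Measurable.of_discrete).aemeasurable, expect_bind, lintegral_toMeasure]
  simp only [hmap]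
  rfl

omit [NeZero N] in
theorem ae_service_le : ∀ᵐ s : Fin N → ℕ ∂(Measure.pi fun n => (M.service n).toMeasure),
    ∀ n, s n ≤ M.Smax := by
  rw [ae_all_iff]
  intro n
  exact (Measure.quasiMeasurePreserving_eval (fun n => (M.service n).toMeasure) n).ae
    (p := fun k : ℕ => k ≤ M.Smax) (ae_le_of_support (M.service_le n))

variable {M} {ε : ℝ} (hε : ε ∈ Set.Ioo 0 M.εmax)

include hε in
theorem ae_arrival_service (r : ℝ) (q : Fin N → ℕ) :
    ∀ᵐ ω ∂M.noise ε r q, ω.2.1 ≤ M.Amax ∧ ∀ n, ω.2.2 n ≤ M.Smax := by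
  have h1 : ∀ᵐ ω ∂M.noise ε r q, ω.2.1 ≤ M.Amax :=
    (Measure.quasiMeasurePreserving_fst.comp Measure.quasiMeasurePreserving_snd).ae
      (ae_le_of_support (M.arrival_le ε hε))
  have h2 : ∀ᵐ ω ∂M.noise ε r q, ∀ n, ω.2.2 n ≤ M.Smax :=
    (Measure.quasiMeasurePreserving_snd.comp Measure.quasiMeasurePreserving_snd).ae M.ae_service_le
  filter_upwards [h1, h2] with ω a b using ⟨a, b⟩

include hε in
theorem memLp_noise (r : ℝ) (q : Fin N → ℕ) (f : Outcome N → ℝ) (p : ℝ≥0∞) :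
    MemLp f p (M.noise ε r q) := by
  refine memLp_of_finite (F := Set.univ ×ˢ (Set.Iic M.Amax ×ˢ Set.Iic fun _ => M.Smax))
    (Set.finite_univ.prod ((Set.finite_Iic _).prod (Set.finite_Iic _))) ?_ f p
  filter_upwards [ae_arrival_service hε r q] with ω hω
  exact ⟨trivial, hω.1, fun n => hω.2 n⟩

include hε in
theorem integrable_noise (r : ℝ) (q : Fin N → ℕ) (f : Outcome N → ℝ) :
    Integrable f (M.noise ε r q) := memLp_one_iff_integrable.1 (memLp_noise hε r q f 1)

include hε in
theorem expect_step_ofReal (r : ℝ) (q : Fin N → ℕ) {F : (Fin N → ℕ) → ℝ} (hF : ∀ x, 0 ≤ F x) :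
    expect (M.step ε r q) (fun x => ENNReal.ofReal (F x)) =
      ENNReal.ofReal (∫ ω, F (after q ω) ∂M.noise ε r q) := by
  rw [expect_step, ofReal_integral_eq_lintegral_ofReal (integrable_noise hε r q _)
    (Eventually.of_forall fun _ => hF _)]

omit [NeZero N] in
include hε in
theorem memLp_arrival (f : ℕ → ℝ) (p : ℝ≥0∞) : MemLp f p (M.arrival ε).toMeasure :=
  memLp_of_finite (Set.finite_Iic M.Amax) (ae_le_of_support (M.arrival_le ε hε)) f p

omit [NeZero N] in
theorem memLp_service (n : Fin N) (f : ℕ → ℝ) (p : ℝ≥0∞) :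
    MemLp f p (M.service n).toMeasure :=
  memLp_of_finite (Set.finite_Iic M.Smax) (ae_le_of_support (M.service_le n)) f p

theorem integral_service (r : ℝ) (q : Fin N → ℕ) (n : Fin N) :
    ∫ ω, (ω.2.2 n : ℝ) ∂M.noise ε r q = M.rate n := by
  rw [noise, integral_fun_snd (fun z : ℕ × (Fin N → ℕ) => (z.2 n : ℝ)),
    integral_fun_snd (fun s : Fin N → ℕ => (s n : ℝ)),
    integral_comp_eval (μ := fun n => (M.service n).toMeasure) (i := n) (f := fun k : ℕ => (k : ℝ))
      (Measurable.of_discrete).aestronglyMeasurable]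
  simp [rate, mean]

include hε in
theorem integral_arrival (r : ℝ) (q : Fin N → ℕ) :
    ∫ ω, (ω.2.1 : ℝ) ∂M.noise ε r q = ∑ m, M.rate m - ε := by
  rw [noise, integral_fun_snd (fun z : ℕ × (Fin N → ℕ) => (z.1 : ℝ)),
    integral_fun_fst (fun a : ℕ => (a : ℝ))]
  simp only [probReal_univ, one_smul]
  exact M.arrival_mean ε hε

include hε in
theorem integral_routed (r : ℝ) (q : Fin N → ℕ) (n : Fin N) :
    ∫ ω, (if n = ω.1 then (ω.2.1 : ℝ) else 0) ∂M.noise ε r q =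
      (M.dispatch r q n).toReal * (∑ m, M.rate m - ε) := by
  have h := integral_prod_mul (μ := (M.dispatch r q).toMeasure)
    (ν := (M.arrival ε).toMeasure.prod (Measure.pi fun n => (M.service n).toMeasure))
    (fun i => if n = i then (1 : ℝ) else 0) (fun z : ℕ × (Fin N → ℕ) => (z.1 : ℝ))
  rw [integral_fun_fst (fun a : ℕ => (a : ℝ))] at h
  have h2 : ∫ i, (if n = i then (1 : ℝ) else 0) ∂(M.dispatch r q).toMeasure =
      (M.dispatch r q n).toReal := by
    rw [PMF.integral_eq_sum]; simp
  rw [h2] at h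
  simp only [probReal_univ, one_smul] at h
  rw [noise]
  refine Eq.trans ?_ (h.trans (congrArg _ (M.arrival_mean ε hε)))
  refine integral_congr_ae (Eventually.of_forall fun ω => ?_)
  by_cases hi : n = ω.1 <;> simp [hi]

include hε in
theorem integral_netInput (r : ℝ) (q : Fin N → ℕ) (n : Fin N) :
    ∫ ω, netInput ω n ∂M.noise ε r q =
      (M.dispatch r q n).toReal * (∑ m, M.rate m - ε) - M.rate n := by
  unfold netInput
  rw [integral_sub (integrable_noise hε r q _) (integrable_noise hε r q _),
    integral_routed hε, integral_service]

theorem sum_netInput {N : ℕ} (ω : Outcome N) :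
    ∑ n, netInput ω n = (ω.2.1 : ℝ) - ∑ n, (ω.2.2 n : ℝ) := by
  simp [netInput, Finset.sum_sub_distrib]

include hε in
theorem integral_sum_netInput (r : ℝ) (q : Fin N → ℕ) :
    ∫ ω, ∑ n, netInput ω n ∂M.noise ε r q = -ε := by
  simp only [sum_netInput]
  rw [integral_sub (integrable_noise hε r q _) (integrable_noise hε r q _),
    integral_finsetSum _ fun _ _ => integrable_noise hε r q _, integral_arrival hε]
  simp only [integral_service]
  ring

include hε in
/-- The second moment of the total net input is the sum of all variances, plus the squared mean. -/
theorem integral_sum_netInput_sq (r : ℝ) (q : Fin N → ℕ) :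
    ∫ ω, (∑ n, netInput ω n) ^ 2 ∂M.noise ε r q =
      var (M.arrival ε) + ∑ n, var (M.service n) + ε ^ 2 := by
  have hS : MemLp (fun s : Fin N → ℕ => -∑ n, (s n : ℝ)) 2
      (Measure.pi fun n => (M.service n).toMeasure) := 
    memLp_of_finite (Set.finite_Iic fun _ => M.Smax) M.ae_service_le _ _
  have hv : Var[fun ω : Outcome N => ∑ n, netInput ω n; M.noise ε r q] =
      var (M.arrival ε) + ∑ n, var (M.service n) := by
    have h1 := variance_add_prod (memLp_arrival hε (fun a => (a : ℝ)) 2) hS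
    have h2 := variance_sum_pi (μ := fun n => (M.service n).toMeasure)
      (X := fun _ k => (k : ℝ)) fun n => memLp_service n _ 2
    have h3 := (measurePreserving_snd (μ := (M.dispatch r q).toMeasure)
      (ν := (M.arrival ε).toMeasure.prod
        (Measure.pi fun n => (M.service n).toMeasure))).variance_fun_comp
      (f := fun p : ℕ × (Fin N → ℕ) => (p.1 : ℝ) + -∑ n, (p.2 n : ℝ))
      (Measurable.of_discrete).aemeasurable
    simp only [sum_netInput, sub_eq_add_neg]
    rw [noise, h3, h1]
    rw [variance_fun_neg]
    congr 1
    refine Eq.trans (congrArg (fun f => Var[f; _]) ?_) h2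
    funext s
    simp
  rw [variance_eq_sub (memLp_noise hε r q _ 2), integral_sum_netInput hε] at hv
  simp only [Pi.pow_apply] at hv
  linarith [neg_sq ε]

include hε in
theorem abs_netInput_le (r : ℝ) (q : Fin N → ℕ) :
    ∀ᵐ ω ∂M.noise ε r q, ∀ n, |netInput ω n| ≤ M.Amax + M.Smax := by
  filter_upwards [ae_arrival_service hε r q] with ω hω n
  have h1 : (ω.2.1 : ℝ) ≤ M.Amax := by exact_mod_cast hω.1
  have h2 : (ω.2.2 n : ℝ) ≤ M.Smax := by exact_mod_cast hω.2 n
  have h3 : (0 : ℝ) ≤ ω.2.1 := Nat.cast_nonneg _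
  have h4 : (0 : ℝ) ≤ ω.2.2 n := Nat.cast_nonneg _
  unfold netInput
  split_ifs <;> rw [abs_le] <;> constructor <;> linarith

end System

/-! ### Routing probabilities and drift conditions -/

namespace System

variable {N : ℕ} [NeZero N] {M : System N}

omit [NeZero N] in
theorem rate_pos (n : Fin N) : 0 < M.rate n := M.service_mean_pos n

theorem sum_rate_pos : 0 < ∑ n, M.rate n :=
  Finset.sum_pos (fun _ _ => rate_pos _) Finset.univ_nonempty

variable (M) in
theorem exists_minRate : ∃ μ₀ > 0, ∀ n, μ₀ ≤ M.rate n :=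
  have ⟨n, hn⟩ := Finite.exists_min M.rate
  ⟨M.rate n, rate_pos n, hn⟩

omit [NeZero N] in
theorem le_sum_rate {ε : ℝ} (hε : ε ∈ Set.Ioo 0 M.εmax) : ε ≤ ∑ n, M.rate n := by
  have h : 0 ≤ mean (M.arrival ε) := integral_nonneg fun _ => Nat.cast_nonneg _
  rw [M.arrival_mean ε hε] at h
  exact sub_nonneg.1 h

theorem dispatch_toReal_of_mem {r : ℝ} {q : Fin N → ℕ} {n : Fin N} (hn : n ∈ candidates r q) :
    (M.dispatch r q n).toReal = M.rate n / ∑ m ∈ candidates r q, M.rate m := by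
  rw [dispatch, PMF.ofFinset_apply, if_pos hn, ENNReal.toReal_ofReal]
  exact div_nonneg (rate_pos n).le (Finset.sum_nonneg fun m _ => (rate_pos m).le)

theorem dispatch_of_notMem {r : ℝ} {q : Fin N → ℕ} {n : Fin N} (hn : n ∉ candidates r q) :
    M.dispatch r q n = 0 := by
  rw [dispatch, PMF.ofFinset_apply, if_neg hn]

theorem sum_dispatch_toReal (r : ℝ) (q : Fin N → ℕ) :
    ∑ n, (M.dispatch r q n).toReal = 1 := by
  rw [← ENNReal.toReal_sum fun n _ => PMF.apply_ne_top _ n, ← tsum_fintype (L := .unconditional _),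
    PMF.tsum_coe, ENNReal.toReal_one]

variable {ε : ℝ} (hε : ε ∈ Set.Ioo 0 M.εmax)

include hε in
theorem step_drift_ofReal {r : ℝ} {V f g : (Fin N → ℕ) → ℝ} (hV : ∀ q, 0 ≤ V q)
    (hf : ∀ q, 0 ≤ f q) (hg : ∀ q, 0 ≤ g q)
    (hd : ∀ q, ∫ ω, V (after q ω) ∂M.noise ε r q + f q ≤ V q + g q) (q : Fin N → ℕ) :
    expect (M.step ε r q) (fun x => ENNReal.ofReal (V x)) + ENNReal.ofReal (f q) ≤
      ENNReal.ofReal (V q) + ENNReal.ofReal (g q) := by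
  rw [expect_step_ofReal hε r q hV, ← ENNReal.ofReal_add (integral_nonneg fun _ => hV _) (hf q),
    ← ENNReal.ofReal_add (hV q) (hg q)]
  exact ENNReal.ofReal_le_ofReal (hd q)

include hε in
theorem IsStationary.expect_le_of_drift {r : ℝ} {π : PMF (Fin N → ℕ)} (h : M.IsStationary ε r π)
    {V f g : (Fin N → ℕ) → ℝ} (hV : ∀ q, 0 ≤ V q) (hf : ∀ q, 0 ≤ f q) (hg : ∀ q, 0 ≤ g q)
    (hd : ∀ q, ∫ ω, V (after q ω) ∂M.noise ε r q + f q ≤ V q + g q) :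
    expect π (fun q => ENNReal.ofReal (f q)) ≤ expect π (fun q => ENNReal.ofReal (g q)) :=
  JBT.expect_le_of_drift h (fun _ => ENNReal.ofReal_ne_top)
    (step_drift_ofReal hε hV hf hg hd)

/-! ### The cubic Lyapunov function and stability -/

theorem posPart_add_cube_le {x y B : ℝ} (hx : 0 ≤ x) (hy : |y| ≤ B) :
    max (x + y) 0 ^ 3 ≤ x ^ 3 + 3 * x ^ 2 * y + 3 * B ^ 2 * x + B ^ 3 := by
  obtain ⟨h1, h2⟩ := abs_le.1 hy
  have hB : 0 ≤ B := (abs_nonneg y).trans hy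
  have hy2 : y ^ 2 ≤ B ^ 2 := sq_le_sq' h1 h2
  rcases le_total 0 (x + y) with h | h
  · rw [max_eq_left h]
    have : y ^ 3 ≤ B ^ 3 := by
      have : Odd 3 := by decide
      exact this.strictMono_pow.monotone h2
    nlinarith [mul_le_mul_of_nonneg_left hy2 hx]
  · rw [max_eq_right h]
    have h3 : 0 ≤ 3 * x ^ 2 * (y + B) := mul_nonneg (by positivity) (by linarith)
    have h4 : 0 ≤ (x - B) ^ 3 + B ^ 3 := by
      have : 0 ≤ x * ((x - 3 * B / 2) ^ 2 + 3 * B ^ 2 / 4) := by positivity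
      nlinarith
    have h5 : 0 ≤ B ^ 3 := by positivity
    nlinarith

include hε in
/-- The net input acts on the squares of the queue lengths with negative drift, up to a constant:
a server below the threshold contributes at most `r ^ 2`, and if no server is below the threshold
then every server receives its share of the load. -/
theorem sum_sq_mul_netInput_le {μ₀ : ℝ} (hμ : ∀ n, μ₀ ≤ M.rate n) (r : ℝ) (q : Fin N → ℕ) :
    ∑ n, (q n : ℝ) ^ 2 * ((M.dispatch r q n).toReal * (∑ m, M.rate m - ε) - M.rate n) ≤
      r ^ 2 * ∑ m, M.rate m - ε * (μ₀ / ∑ m, M.rate m) * ∑ n, (q n : ℝ) ^ 2 := by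
  set S := ∑ m, M.rate m with hS
  have hSpos : 0 < S := sum_rate_pos
  have hεS : ε ≤ S := le_sum_rate hε
  have hserv : ε / S * ∑ n, (q n : ℝ) ^ 2 * M.rate n ≥
      ε * (μ₀ / S) * ∑ n, (q n : ℝ) ^ 2 := by
    rw [show ε * (μ₀ / S) * ∑ n, (q n : ℝ) ^ 2 = ε / S * ∑ n, (q n : ℝ) ^ 2 * μ₀ by
      rw [← Finset.sum_mul]; ring]
    have := hε.1
    gcongr with n
    exact hμ n
  by_cases hm : (memory r q).Nonempty
  · have hc : candidates r q = memory r q := if_pos hm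
    have h1 : ∑ n, (q n : ℝ) ^ 2 * ((M.dispatch r q n).toReal * (S - ε)) ≤
        ∑ n, r ^ 2 * ((M.dispatch r q n).toReal * (S - ε)) := by
      refine Finset.sum_le_sum fun n _ => ?_
      by_cases hn : n ∈ memory r q
      · have hlt : (q n : ℝ) < r := by simpa [memory] using hn
        have : 0 ≤ S - ε := by linarith
        gcongr
      · rw [dispatch_of_notMem (hc ▸ hn)]; simp
    rw [← Finset.mul_sum, ← Finset.sum_mul, sum_dispatch_toReal, one_mul] at h1
    have h2 : ε / S * ∑ n, (q n : ℝ) ^ 2 * M.rate n ≤ ∑ n, (q n : ℝ) ^ 2 * M.rate n :=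
      mul_le_of_le_one_left (Finset.sum_nonneg fun n _ => mul_nonneg (sq_nonneg _) (rate_pos n).le)
        ((div_le_one hSpos).2 hεS)
    have h3 : r ^ 2 * (S - ε) ≤ r ^ 2 * S := by
      have := hε.1
      gcongr; linarith
    simp only [mul_sub (_ ^ 2 : ℝ), Finset.sum_sub_distrib]
    simp only [mul_sub] at h1 h3 ⊢
    linarith
  · have hc : candidates r q = Finset.univ := if_neg hm
    have h1 : ∀ n, (q n : ℝ) ^ 2 * ((M.dispatch r q n).toReal * (S - ε) - M.rate n) =
        -(ε / S * ((q n : ℝ) ^ 2 * M.rate n)) := by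
      intro n
      rw [dispatch_toReal_of_mem (hc ▸ Finset.mem_univ n), hc, ← hS]
      field_simp
      ring
    rw [Finset.sum_congr rfl fun n _ => h1 n, Finset.sum_neg_distrib, ← Finset.mul_sum]
    have : 0 ≤ r ^ 2 * S := by positivity
    linarith

include hε in
/-- The drift of `∑ q n ^ 3`. The linear terms are absorbed by one third of the negative quadratic
drift, which leaves a constant of order `1 / ε`. -/
theorem cubic_drift {μ₀ : ℝ} (hμ₀ : 0 < μ₀) (hμ : ∀ n, μ₀ ≤ M.rate n) (r : ℝ) (q : Fin N → ℕ) :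
    ∫ ω, ∑ n, (after q ω n : ℝ) ^ 3 ∂M.noise ε r q +
        2 * ε * (μ₀ / ∑ m, M.rate m) * ∑ n, (q n : ℝ) ^ 2 ≤
      ∑ n, (q n : ℝ) ^ 3 + (3 * r ^ 2 * ∑ m, M.rate m +
        N * (9 * (M.Amax + M.Smax : ℝ) ^ 4 / (4 * (ε * (μ₀ / ∑ m, M.rate m))) +
          (M.Amax + M.Smax : ℝ) ^ 3)) := by
  set S := ∑ m, M.rate m with hS
  set B : ℝ := M.Amax + M.Smax with hB
  have hc : 0 < ε * (μ₀ / S) := mul_pos hε.1 (div_pos hμ₀ sum_rate_pos)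
  have hint := integrable_noise hε r q
  have h1 : ∫ ω, ∑ n, (after q ω n : ℝ) ^ 3 ∂M.noise ε r q ≤
      ∫ ω, ∑ n, ((q n : ℝ) ^ 3 + 3 * (q n : ℝ) ^ 2 * netInput ω n + 3 * B ^ 2 * q n + B ^ 3)
        ∂M.noise ε r q := by
    refine integral_mono_ae (hint _) (hint _) ?_
    filter_upwards [abs_netInput_le hε r q] with ω hω
    refine Finset.sum_le_sum fun n _ => ?_
    rw [after_apply]
    exact posPart_add_cube_le (Nat.cast_nonneg _) (hω n)
  have h2 : ∫ ω, ∑ n, ((q n : ℝ) ^ 3 + 3 * (q n : ℝ) ^ 2 * netInput ω n + 3 * B ^ 2 * q n + B ^ 3)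
        ∂M.noise ε r q = ∑ n, (q n : ℝ) ^ 3 +
      3 * (∑ n, (q n : ℝ) ^ 2 * ((M.dispatch r q n).toReal * (S - ε) - M.rate n)) +
      ∑ n, (3 * B ^ 2 * (q n : ℝ) + B ^ 3) := by
    rw [integral_finsetSum _ fun _ _ => hint _, Finset.mul_sum, ← Finset.sum_add_distrib,
      ← Finset.sum_add_distrib]
    refine Finset.sum_congr rfl fun n _ => ?_
    rw [integral_add (hint _) (hint _), integral_add (hint _) (hint _),
      integral_add (hint _) (hint _), integral_const_mul, integral_netInput hε]
    simp only [integral_const, probReal_univ, one_smul]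
    ring
  have h3 := sum_sq_mul_netInput_le hε hμ r q
  have h4 : ∑ n, (3 * B ^ 2 * (q n : ℝ) + B ^ 3) ≤ ε * (μ₀ / S) * ∑ n, (q n : ℝ) ^ 2 +
      N * (9 * B ^ 4 / (4 * (ε * (μ₀ / S))) + B ^ 3) := by
    have : (N : ℝ) * (9 * B ^ 4 / (4 * (ε * (μ₀ / S))) + B ^ 3) =
        ∑ _n : Fin N, (9 * B ^ 4 / (4 * (ε * (μ₀ / S))) + B ^ 3) := by simp [mul_add]
    rw [this, Finset.mul_sum, ← Finset.sum_add_distrib]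
    refine Finset.sum_le_sum fun n _ => ?_
    set c := ε * (μ₀ / S)
    have : c * (q n : ℝ) ^ 2 + 9 * B ^ 4 / (4 * c) - 3 * B ^ 2 * q n =
        (2 * c * q n - 3 * B ^ 2) ^ 2 / (4 * c) := by
      field_simp; ring
    have h0 : 0 ≤ (2 * c * q n - 3 * B ^ 2) ^ 2 / (4 * c) := by positivity
    linarith
  rw [← hS] at h3
  linarith

theorem sq_le_sum_sq {N : ℕ} (q : Fin N → ℕ) (n : Fin N) : (q n : ℝ) ^ 2 ≤ ∑ n, (q n : ℝ) ^ 2 :=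
  Finset.single_le_sum (f := fun n => (q n : ℝ) ^ 2) (fun _ _ => sq_nonneg _) (Finset.mem_univ n)

include hε in
theorem exists_isStationary (r : ℝ) : ∃ π, M.IsStationary ε r π := by
  obtain ⟨μ₀, hμ₀, hμ⟩ := M.exists_minRate
  have hS : 0 < ∑ m, M.rate m := sum_rate_pos
  have hε0 := hε.1
  refine exists_invariant (x₀ := 0) (V := fun q => ENNReal.ofReal (∑ n, (q n : ℝ) ^ 3))
    (f := fun q => ENNReal.ofReal (2 * ε * (μ₀ / ∑ m, M.rate m) * ∑ n, (q n : ℝ) ^ 2))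
    (ENNReal.ofReal_ne_top) (by simp)
    (step_drift_ofReal hε (fun q => by positivity) (fun q => by positivity)
      (g := fun _ => _) (fun _ => ?_) (cubic_drift hε hμ₀ hμ r)) fun m => ?_
  · positivity
  · set c := 2 * ε * (μ₀ / ∑ m, M.rate m)
    have hc : 0 < c := by positivity
    refine (Set.finite_Iic fun _ : Fin N => ⌈(m : ℝ) / c⌉₊).subset fun q hq n => ?_
    have hq' : c * ∑ n, (q n : ℝ) ^ 2 ≤ m := by
      rw [← ENNReal.ofReal_le_ofReal_iff (Nat.cast_nonneg m), ENNReal.ofReal_natCast]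
      exact hq
    have h1 : (q n : ℝ) ≤ (q n : ℝ) ^ 2 := by exact_mod_cast Nat.le_self_pow two_ne_zero (q n)
    have h2 : (q n : ℝ) ≤ m / c := by
      rw [le_div_iff₀ hc]
      nlinarith [sq_le_sum_sq q n]
    exact_mod_cast h2.trans (Nat.le_ceil _)

omit [NeZero N] in
theorem exists_service_pos (n : Fin N) : ∃ k, k ≠ 0 ∧ M.service n k ≠ 0 := by
  by_contra! h
  have h0 : mean (M.service n) = 0 := by
    rw [mean, PMF.integral_eq_tsum _ _ ((memLp_service n _ 1).integrable le_rfl)]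
    refine (tsum_congr fun k => ?_).trans tsum_zero
    by_cases hk : k = 0
    · simp [hk]
    · simp [h k hk]
  exact (M.service_mean_pos n).ne' h0

include hε in
/-- Without arrivals, and if every server offers service, the total queue length decreases. -/
theorem exists_step_lt (r : ℝ) (q : Fin N → ℕ) (hq : q ≠ 0) :
    ∃ q', ∑ n, q' n < ∑ n, q n ∧ M.step ε r q q' ≠ 0 := by
  choose s hs0 hs using fun n => exists_service_pos (M := M) n
  obtain ⟨i, hi⟩ := (M.dispatch r q).support_nonempty
  refine ⟨next q i 0 s, ?_, ?_⟩
  · obtain ⟨n, hn⟩ := Function.ne_iff.1 hq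
    have hn' : q n ≠ 0 := hn
    refine Finset.sum_lt_sum (fun m _ => ?_) ⟨n, Finset.mem_univ n, ?_⟩
    · simp [next]
    · have := hs0 n
      simp only [next, ite_self]
      omega
  · rw [← PMF.mem_support_iff, step, PMF.mem_support_bind_iff]
    refine ⟨i, hi, ?_⟩
    rw [PMF.mem_support_bind_iff]
    refine ⟨0, (M.arrival_zero ε hε).ne', ?_⟩
    rw [PMF.mem_support_map_iff]
    have hprod : indepPMF M.service s = ∏ n, M.service n (s n) := rfl
    refine ⟨s, ?_, rfl⟩
    rw [PMF.mem_support_iff, hprod]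
    exact Finset.prod_ne_zero_iff.2 fun n _ => hs n

include hε in
theorem existsUnique_isStationary (r : ℝ) : ∃! π, M.IsStationary ε r π :=
  existsUnique_of_exists_of_unique (exists_isStationary hε r) fun _ _ h₁ h₂ =>
    invariant_unique (fun q => ∑ n, q n) (exists_step_lt hε r) h₁ h₂

include hε in
/-- The second moments of the stationary queue lengths. -/
theorem IsStationary.expect_sum_sq_le {r : ℝ} {π : PMF (Fin N → ℕ)} (h : M.IsStationary ε r π)
    {μ₀ : ℝ} (hμ₀ : 0 < μ₀) (hμ : ∀ n, μ₀ ≤ M.rate n) :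
    expect π (fun q => ENNReal.ofReal (∑ n, (q n : ℝ) ^ 2)) ≤
      ENNReal.ofReal ((2 * ε * (μ₀ / ∑ m, M.rate m))⁻¹ * (3 * r ^ 2 * ∑ m, M.rate m +
        N * (9 * (M.Amax + M.Smax : ℝ) ^ 4 / (4 * (ε * (μ₀ / ∑ m, M.rate m))) +
          (M.Amax + M.Smax : ℝ) ^ 3))) := by
  have hS : 0 < ∑ m, M.rate m := sum_rate_pos
  have hε0 := hε.1
  have h1 := h.expect_le_of_drift hε (V := fun q => ∑ n, (q n : ℝ) ^ 3)
    (f := fun q => 2 * ε * (μ₀ / ∑ m, M.rate m) * ∑ n, (q n : ℝ) ^ 2) (g := fun _ => _)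
    (fun q => by positivity) (fun q => by positivity) (fun _ => by positivity)
    (cubic_drift hε hμ₀ hμ r)
  have hc : 0 < 2 * ε * (μ₀ / ∑ m, M.rate m) := by positivity
  simp only [ENNReal.ofReal_mul hc.le] at h1
  rw [expect_const_mul, expect_const] at h1
  rw [ENNReal.ofReal_mul (by positivity), ENNReal.ofReal_inv_of_pos hc, mul_comm,
    ← div_eq_mul_inv, ENNReal.le_div_iff_mul_le
      (Or.inl (by simpa using hc)) (Or.inl ENNReal.ofReal_ne_top), mul_comm]
  exact h1

end System

/-! ### The distance to the region -/

section Region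

variable {N : ℕ}

theorem norm_le_norm_of_abs_le {x y : EuclideanSpace ℝ (Fin N)} (h : ∀ n, |x n| ≤ |y n|) :
    ‖x‖ ≤ ‖y‖ := by
  rw [EuclideanSpace.norm_eq, EuclideanSpace.norm_eq]
  refine Real.sqrt_le_sqrt (Finset.sum_le_sum fun n _ => ?_)
  exact pow_le_pow_left₀ (norm_nonneg _) (h n) 2

theorem norm_le_sum_abs (x : EuclideanSpace ℝ (Fin N)) : ‖x‖ ≤ ∑ n, |x n| := by
  rw [EuclideanSpace.norm_eq]
  refine Real.sqrt_le_iff.2 ⟨Finset.sum_nonneg fun _ _ => abs_nonneg _, ?_⟩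
  simpa only [Real.norm_eq_abs] using
    Finset.sum_sq_le_sq_sum_of_nonneg (s := Finset.univ) fun n _ => abs_nonneg (x n)

/-- How much the queue lengths exceed the threshold. -/
noncomputable def excess (r : ℝ) (q : Fin N → ℕ) : EuclideanSpace ℝ (Fin N) :=
  WithLp.toLp 2 fun n => max ((q n : ℝ) - r) 0

/-- How much the queue lengths fall short of the threshold. -/
noncomputable def deficit (r : ℝ) (q : Fin N → ℕ) : EuclideanSpace ℝ (Fin N) :=
  WithLp.toLp 2 fun n => max (r - q n) 0

@[simp] theorem excess_apply (r : ℝ) (q : Fin N → ℕ) (n : Fin N) :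
    excess r q n = max ((q n : ℝ) - r) 0 := rfl

@[simp] theorem deficit_apply (r : ℝ) (q : Fin N → ℕ) (n : Fin N) :
    deficit r q n = max (r - q n) 0 := rfl

theorem distRegion_nonneg (r : ℝ) (q : Fin N → ℕ) : 0 ≤ distRegion r q := Metric.infDist_nonneg

theorem distRegion_le_excess {r : ℝ} (hr : 0 ≤ r) (q : Fin N → ℕ) :
    distRegion r q ≤ ‖excess r q‖ := by
  have hmem : WithLp.toLp 2 (fun n => min (q n : ℝ) r) ∈ region N r :=
    Or.inl ⟨fun n => le_min (Nat.cast_nonneg _) hr, fun n => min_le_right _ _⟩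
  refine (Metric.infDist_le_dist_of_mem hmem).trans ?_
  rw [dist_eq_norm]
  refine norm_le_norm_of_abs_le fun n => le_of_eq ?_
  simp only [PiLp.sub_apply, excess_apply]
  congr 1
  rcases le_total (q n : ℝ) r with h | h
  · rw [min_eq_left h, max_eq_right (by linarith), sub_self]
  · rw [min_eq_right h, max_eq_left (by linarith)]

theorem distRegion_le_deficit (r : ℝ) (q : Fin N → ℕ) :
    distRegion r q ≤ ‖deficit r q‖ := by
  have hmem : WithLp.toLp 2 (fun n => max (q n : ℝ) r) ∈ region N r :=
    Or.inr ⟨fun n => le_max_of_le_left (Nat.cast_nonneg _), fun n => le_max_right _ _⟩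
  refine (Metric.infDist_le_dist_of_mem hmem).trans ?_
  rw [dist_eq_norm]
  refine norm_le_norm_of_abs_le fun n => le_of_eq ?_
  simp only [PiLp.sub_apply, deficit_apply]
  rcases le_total (q n : ℝ) r with h | h
  · rw [max_eq_right h, max_eq_left (by linarith), abs_sub_comm]
  · rw [max_eq_left h, max_eq_right (by linarith), sub_self]

theorem min_le_distRegion (r : ℝ) (q : Fin N → ℕ) :
    min ‖excess r q‖ ‖deficit r q‖ ≤ distRegion r q := by
  have hne : (region N r).Nonempty :=
    ⟨WithLp.toLp 2 (fun n => max (q n : ℝ) r),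
      Or.inr ⟨fun n => le_max_of_le_left (Nat.cast_nonneg _), fun n => le_max_right _ _⟩⟩
  refine (Metric.le_infDist hne).2 fun x hx => ?_
  rw [dist_eq_norm]
  rcases hx with hx | hx
  · refine (min_le_left _ _).trans (norm_le_norm_of_abs_le fun n => ?_)
    have := hx.2 n
    simp only [PiLp.sub_apply, excess_apply]
    rw [abs_of_nonneg (le_max_right _ _)]
    exact max_le ((by linarith : (q n : ℝ) - r ≤ q n - x n).trans (le_abs_self _)) (abs_nonneg _)
  · refine (min_le_right _ _).trans (norm_le_norm_of_abs_le fun n => ?_)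
    have := hx.2 n
    simp only [PiLp.sub_apply, deficit_apply]
    rw [abs_of_nonneg (le_max_right _ _), abs_sub_comm]
    exact max_le ((by linarith : r - (q n : ℝ) ≤ x n - q n).trans (le_abs_self _)) (abs_nonneg _)

theorem le_norm_excess (r : ℝ) (q : Fin N → ℕ) (n : Fin N) : (q n : ℝ) - r ≤ ‖excess r q‖ :=
  calc (q n : ℝ) - r ≤ excess r q n := le_max_left _ _
    _ ≤ ‖excess r q n‖ := le_abs_self _
    _ ≤ _ := PiLp.norm_apply_le _ n

theorem le_norm_deficit (r : ℝ) (q : Fin N → ℕ) (n : Fin N) : r - (q n : ℝ) ≤ ‖deficit r q‖ :=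
  calc r - (q n : ℝ) ≤ deficit r q n := le_max_left _ _
    _ ≤ ‖deficit r q n‖ := le_abs_self _
    _ ≤ _ := PiLp.norm_apply_le _ n

/-- Off the region, some server is below the threshold and some server is above it. -/
theorem exists_lt_of_distRegion_pos {r : ℝ} (hr : 0 ≤ r) {q : Fin N → ℕ}
    (h : 0 < distRegion r q) : (∃ n, (q n : ℝ) < r) ∧ ∃ n, r < q n := by
  constructor
  · by_contra! hn
    have : deficit r q = 0 := by
      ext n; simp [hn n]
    have h2 := distRegion_le_deficit r q
    rw [this, norm_zero] at h2
    exact h.not_ge h2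
  · by_contra! hn
    have : excess r q = 0 := by
      ext n; simp [hn n]
    have h2 := distRegion_le_excess hr q
    rw [this, norm_zero] at h2
    exact h.not_ge h2

end Region

namespace System

/-! ### Exponential drift of the distance to the region -/

/-- The net input of a slot as a Euclidean vector. -/
noncomputable def netInputVec {N : ℕ} (ω : Outcome N) : EuclideanSpace ℝ (Fin N) :=
  WithLp.toLp 2 (netInput ω)

@[simp] theorem netInputVec_apply {N : ℕ} (ω : Outcome N) (n : Fin N) :
    netInputVec ω n = netInput ω n := rfl

theorem distRegion_after_le_excess {N : ℕ} {r : ℝ} (hr : 0 ≤ r) (q : Fin N → ℕ) (ω : Outcome N) :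
    distRegion r (after q ω) ≤ ‖excess r q + netInputVec ω‖ := by
  refine (distRegion_le_excess hr _).trans (norm_le_norm_of_abs_le fun n => ?_)
  simp only [excess_apply, PiLp.add_apply, netInputVec_apply, after_apply]
  rw [abs_of_nonneg (le_max_right _ _)]
  refine max_le ?_ (abs_nonneg _)
  have h1 := le_abs_self (max ((q n : ℝ) - r) 0 + netInput ω n)
  have h2 := le_max_left ((q n : ℝ) - r) 0
  rcases le_total ((q n : ℝ) + netInput ω n) 0 with h | h
  · rw [max_eq_right h]; linarith [abs_nonneg (max ((q n : ℝ) - r) 0 + netInput ω n)]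
  · rw [max_eq_left h]; linarith

theorem distRegion_after_le_deficit {N : ℕ} (r : ℝ) (q : Fin N → ℕ) (ω : Outcome N) :
    distRegion r (after q ω) ≤ ‖deficit r q + -netInputVec ω‖ := by
  refine (distRegion_le_deficit r _).trans (norm_le_norm_of_abs_le fun n => ?_)
  simp only [deficit_apply, PiLp.add_apply, PiLp.neg_apply, netInputVec_apply, after_apply]
  rw [abs_of_nonneg (le_max_right _ _)]
  refine max_le ?_ (abs_nonneg _)
  have h1 := le_abs_self (max (r - (q n : ℝ)) 0 + -netInput ω n)
  have h2 := le_max_left (r - (q n : ℝ)) 0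
  have h3 := le_max_left ((q n : ℝ) + netInput ω n) 0
  linarith

/-- If `v` has nonnegative coordinates and the bounded random vector `Y` pushes every positive
coordinate down, then `exp (θ * ‖v + Y‖)` has geometric drift for small `θ` and large `‖v‖`. -/
theorem integral_exp_norm_add_le {N : ℕ} {Ω : Type*} [MeasurableSpace Ω] {P : Measure Ω}
    [IsProbabilityMeasure P] (hint : ∀ f : Ω → ℝ, Integrable f P)
    {v : EuclideanSpace ℝ (Fin N)} (hv : ∀ n, 0 ≤ v n) {Y : Ω → EuclideanSpace ℝ (Fin N)}
    {D δ θ : ℝ} (hD : ∀ᵐ ω ∂P, ‖Y ω‖ ≤ D) (hδ : 0 < δ)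
    (hY : ∀ n, 0 < v n → ∫ ω, Y ω n ∂P ≤ -δ) (hvL : D ^ 2 / δ ≤ ‖v‖) (hv0 : 0 < ‖v‖)
    (hθ : 0 ≤ θ) (hθD : θ * D ≤ 1) (hθδ : θ * D ^ 2 ≤ δ / 4) :
    ∫ ω, Real.exp (θ * ‖v + Y ω‖) ∂P ≤ (1 - θ * δ / 4) * Real.exp (θ * ‖v‖) := by
  have hdrift : ∫ ω, (‖v + Y ω‖ - ‖v‖) ∂P ≤ -(δ / 2) := by
    have h1 : ∫ ω, (‖v + Y ω‖ - ‖v‖) ∂P ≤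
        ∫ ω, (2 * ∑ n, v n * Y ω n + D ^ 2) / (2 * ‖v‖) ∂P := by
      refine integral_mono_ae (hint _) (hint _) ?_
      filter_upwards [hD] with ω hω
      -- `‖v + Y‖ - ‖v‖ ≤ (‖v + Y‖ ^ 2 - ‖v‖ ^ 2) / (2 * ‖v‖)`
      rw [le_div_iff₀ (by positivity)]
      have h2 := norm_add_sq_real v (Y ω)
      have h3 : inner ℝ v (Y ω) = ∑ n, v n * Y ω n := by
        rw [PiLp.inner_apply]
        exact Finset.sum_congr rfl fun n _ => by simp [mul_comm]
      have h4 : ‖Y ω‖ ^ 2 ≤ D ^ 2 := pow_le_pow_left₀ (norm_nonneg _) hω 2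
      rw [h3] at h2
      nlinarith [sq_nonneg (‖v + Y ω‖ - ‖v‖)]
    have h2 : ∫ ω, (2 * ∑ n, v n * Y ω n + D ^ 2) / (2 * ‖v‖) ∂P =
        (2 * ∑ n, v n * ∫ ω, Y ω n ∂P + D ^ 2) / (2 * ‖v‖) := by
      rw [integral_div, integral_add (hint _) (hint _), integral_const_mul,
        integral_finsetSum _ fun _ _ => hint _]
      simp [integral_const_mul]
    have h3 : ∑ n, v n * ∫ ω, Y ω n ∂P ≤ -δ * ‖v‖ := by
      have h4 : ∑ n, v n * ∫ ω, Y ω n ∂P ≤ ∑ n, v n * -δ := by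
        refine Finset.sum_le_sum fun n _ => ?_
        rcases (hv n).eq_or_lt with h0 | h0
        · simp [← h0]
        · exact mul_le_mul_of_nonneg_left (hY n h0) h0.le
      rw [← Finset.sum_mul] at h4
      have h5 := norm_le_sum_abs v
      simp only [abs_of_nonneg (hv _)] at h5
      nlinarith
    rw [h2] at h1
    refine h1.trans ?_
    rw [div_le_iff₀ (by positivity)]
    rw [div_le_iff₀ hδ] at hvL
    nlinarith
  have hexp : ∫ ω, Real.exp (θ * (‖v + Y ω‖ - ‖v‖)) ∂P ≤ 1 - θ * δ / 4 := by
    calc ∫ ω, Real.exp (θ * (‖v + Y ω‖ - ‖v‖)) ∂P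
        ≤ ∫ ω, (1 + θ * (‖v + Y ω‖ - ‖v‖) + θ ^ 2 * D ^ 2) ∂P := by
          refine integral_mono_ae (hint _) (hint _) ?_
          filter_upwards [hD] with ω hω
          have h0 : |‖v + Y ω‖ - ‖v‖| ≤ D := by
            refine (abs_norm_sub_norm_le _ _).trans ?_
            simpa using hω
          have h1 : |θ * (‖v + Y ω‖ - ‖v‖)| ≤ 1 := by
            rw [abs_mul, abs_of_nonneg hθ]
            exact (mul_le_mul_of_nonneg_left h0 hθ).trans hθD
          have h2 := (abs_le.1 (Real.abs_exp_sub_one_sub_id_le h1)).2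
          have h3 : (‖v + Y ω‖ - ‖v‖) ^ 2 ≤ D ^ 2 := sq_le_sq' (abs_le.1 h0).1 (abs_le.1 h0).2
          have h4 := mul_le_mul_of_nonneg_left h3 (sq_nonneg θ)
          rw [mul_pow] at h2
          linarith
      _ = 1 + θ * ∫ ω, (‖v + Y ω‖ - ‖v‖) ∂P + θ ^ 2 * D ^ 2 := by
          rw [integral_add (hint _) (hint _), integral_add (hint _) (hint _), integral_const_mul]
          simp
      _ ≤ _ := by nlinarith
  have hsplit : ∀ ω, Real.exp (θ * ‖v + Y ω‖) =
      Real.exp (θ * (‖v + Y ω‖ - ‖v‖)) * Real.exp (θ * ‖v‖) := fun ω => by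
    rw [← Real.exp_add]; ring_nf
  simp only [hsplit]
  rw [integral_mul_const]
  gcongr

variable {N : ℕ} [NeZero N] {M : System N}

omit [NeZero N] in
/-- The drift of the servers below the threshold towards it: they receive all arrivals, whose rate
exceeds the total service rate of these servers. -/
theorem le_arrival_share {ε μ₀ : ℝ} (hμ₀ : 0 < μ₀) (hμ : ∀ n, μ₀ ≤ M.rate n) (hεμ : ε ≤ μ₀ / 2)
    {s : Finset (Fin N)} {m : Fin N} (hm : m ∉ s) {n : Fin N} (hn : n ∈ s) :
    μ₀ ^ 2 / (2 * ∑ j, M.rate j) ≤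
      (M.rate n / ∑ j ∈ s, M.rate j) * (∑ j, M.rate j - ε) - M.rate n := by
  have hR : 0 < ∑ j ∈ s, M.rate j := Finset.sum_pos (fun j _ => rate_pos j) ⟨n, hn⟩
  have hRS : ∑ j ∈ s, M.rate j + μ₀ ≤ ∑ j, M.rate j := by
    have h1 : ∑ j ∈ insert m s, M.rate j ≤ ∑ j, M.rate j :=
      Finset.sum_le_sum_of_subset_of_nonneg (Finset.subset_univ _) fun j _ _ => (rate_pos j).le
    rw [Finset.sum_insert hm] at h1
    linarith [hμ m]
  generalize ∑ j, M.rate j = S at *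
  generalize ∑ j ∈ s, M.rate j = R at *
  have hS : 0 < S := by linarith
  have h1 : M.rate n / R * (S - ε) - M.rate n = M.rate n * ((S - ε - R) / R) := by
    field_simp
  have h2 : μ₀ / 2 / S ≤ (S - ε - R) / R :=
    div_le_div₀ (by linarith) (by linarith) hR (by linarith)
  rw [h1]
  calc μ₀ ^ 2 / (2 * S) = μ₀ * (μ₀ / 2 / S) := by field_simp
    _ ≤ M.rate n * ((S - ε - R) / R) :=
      mul_le_mul (hμ n) h2 (by positivity) (rate_pos n).le

variable {ε : ℝ} (hε : ε ∈ Set.Ioo 0 M.εmax)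

include hε in
theorem norm_netInputVec_le (r : ℝ) (q : Fin N → ℕ) :
    ∀ᵐ ω ∂M.noise ε r q, ‖netInputVec ω‖ ≤ N * (M.Amax + M.Smax) := by
  filter_upwards [abs_netInput_le hε r q] with ω hω
  refine (norm_le_sum_abs _).trans ?_
  refine (Finset.sum_le_sum fun n _ => hω n).trans ?_
  simp [mul_add]

/-- The geometric drift condition for `exp (θ * d)`, where `d` has the value `‖v‖` before the slot
and is at most `‖v + Y‖` after it. For `‖v‖ < D ^ 2 / δ` the drift of `Y` is not used. -/
theorem exp_drift_of_vec {N : ℕ} {Ω : Type*} [MeasurableSpace Ω] {P : Measure Ω}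
    [IsProbabilityMeasure P] (hint : ∀ f : Ω → ℝ, Integrable f P)
    {v : EuclideanSpace ℝ (Fin N)} (hv : ∀ n, 0 ≤ v n) {Y : Ω → EuclideanSpace ℝ (Fin N)}
    {D δ θ : ℝ} (hD0 : 0 < D) (hD : ∀ᵐ ω ∂P, ‖Y ω‖ ≤ D) (hδ : 0 < δ)
    (hY : 0 < ‖v‖ → ∀ n, 0 < v n → ∫ ω, Y ω n ∂P ≤ -δ)
    (hθ : 0 ≤ θ) (hθD : θ * D ≤ 1) (hθδ : θ * D ^ 2 ≤ δ / 4) (hθ1 : θ * δ ≤ 1)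
    {d : Ω → ℝ} (hd : ∀ ω, d ω ≤ ‖v + Y ω‖) :
    ∫ ω, Real.exp (θ * d ω) ∂P + θ * δ / 4 * Real.exp (θ * ‖v‖) ≤
      Real.exp (θ * ‖v‖) + Real.exp (θ * (D ^ 2 / δ + D)) := by
  have h1 : ∫ ω, Real.exp (θ * d ω) ∂P ≤ ∫ ω, Real.exp (θ * ‖v + Y ω‖) ∂P :=
    integral_mono (hint _) (hint _) fun ω => by
      have := hd ω
      dsimp only
      gcongr
  rcases le_or_gt (D ^ 2 / δ) ‖v‖ with hL | hL
  · have hv0 : 0 < ‖v‖ := lt_of_lt_of_le (by positivity) hL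
    have h2 := integral_exp_norm_add_le hint hv hD hδ (hY hv0) hL hv0 hθ hθD hθδ
    have := Real.exp_pos (θ * (D ^ 2 / δ + D))
    linarith
  · have h2 : ∫ ω, Real.exp (θ * ‖v + Y ω‖) ∂P ≤ ∫ _ω, Real.exp (θ * (D ^ 2 / δ + D)) ∂P := by
      refine integral_mono_ae (hint _) (hint _) ?_
      filter_upwards [hD] with ω hω
      have := norm_add_le v (Y ω)
      gcongr
      linarith
    rw [integral_const, probReal_univ, one_smul] at h2
    have := Real.exp_pos (θ * ‖v‖)
    nlinarith

include hε in
/-- Geometric drift of `exp (θ * distRegion r q)`, with constants that depend neither on `ε` nor on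
the threshold. -/
theorem exp_distRegion_drift {μ₀ D θ : ℝ} (hμ₀ : 0 < μ₀) (hμ : ∀ n, μ₀ ≤ M.rate n)
    (hεμ : ε ≤ μ₀ / 2) (hD0 : 0 < D) (hDN : N * (M.Amax + M.Smax) ≤ D) (hθ : 0 ≤ θ)
    (hθD : θ * D ≤ 1) (hθδ : θ * D ^ 2 ≤ μ₀ ^ 2 / (2 * ∑ j, M.rate j) / 4)
    (hθ1 : θ * (μ₀ ^ 2 / (2 * ∑ j, M.rate j)) ≤ 1) {r : ℝ} (hr : 0 ≤ r) (q : Fin N → ℕ) :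
    ∫ ω, Real.exp (θ * distRegion r (after q ω)) ∂M.noise ε r q +
        θ * (μ₀ ^ 2 / (2 * ∑ j, M.rate j)) / 4 * Real.exp (θ * distRegion r q) ≤
      Real.exp (θ * distRegion r q) +
        Real.exp (θ * (D ^ 2 / (μ₀ ^ 2 / (2 * ∑ j, M.rate j)) + D)) := by
  have hS : 0 < ∑ j, M.rate j := sum_rate_pos
  set δ := μ₀ ^ 2 / (2 * ∑ j, M.rate j) with hδ
  have hδ0 : 0 < δ := by positivity
  have hδμ : δ ≤ μ₀ := by
    have h1 : μ₀ ≤ ∑ j, M.rate j := (hμ 0).trans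
      (Finset.single_le_sum (fun j _ => (rate_pos j).le) (Finset.mem_univ 0))
    rw [hδ, div_le_iff₀ (by positivity)]
    nlinarith
  have hYD : ∀ᵐ ω ∂M.noise ε r q, ‖netInputVec ω‖ ≤ D :=
    (norm_netInputVec_le hε r q).mono fun ω h => h.trans hDN
  have hint := integrable_noise hε r q
  have hcand : 0 < distRegion r q → candidates r q = memory r q ∧ ∃ m, m ∉ memory r q := by
    intro h0
    obtain ⟨⟨n, hn⟩, m, hm⟩ := exists_lt_of_distRegion_pos hr h0
    exact ⟨if_pos ⟨n, by simpa [memory] using hn⟩, m, by simpa [memory] using hm.le⟩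
  rcases le_total ‖excess r q‖ ‖deficit r q‖ with hle | hle
  · have hd : distRegion r q = ‖excess r q‖ :=
      le_antisymm (distRegion_le_excess hr q) ((min_eq_left hle).ge.trans (min_le_distRegion r q))
    rw [hd]
    refine exp_drift_of_vec hint (fun n => le_max_right _ _) hD0 hYD hδ0 (fun h0 n hn => ?_) hθ hθD
      hθδ hθ1 (distRegion_after_le_excess hr q)
    have hq : r < q n := by simpa using hn
    have hn' : n ∉ candidates r q := by
      rw [(hcand (hd ▸ h0)).1]; simpa [memory] using hq.le
    simp only [netInputVec_apply]
    rw [integral_netInput hε, dispatch_of_notMem hn', ENNReal.toReal_zero]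
    linarith [hμ n]
  · have hd : distRegion r q = ‖deficit r q‖ :=
      le_antisymm (distRegion_le_deficit r q) ((min_eq_right hle).ge.trans (min_le_distRegion r q))
    rw [hd]
    refine exp_drift_of_vec hint (fun n => le_max_right _ _) (Y := fun ω => -netInputVec ω) hD0
      (by simpa only [norm_neg] using hYD) hδ0 (fun h0 n hn => ?_) hθ hθD
      hθδ hθ1 (distRegion_after_le_deficit r q)
    have hq : (q n : ℝ) < r := by simpa using hn
    obtain ⟨hc, m, hm⟩ := hcand (hd ▸ h0)
    have hn' : n ∈ candidates r q := by
      rw [hc]; simpa [memory] using hq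
    simp only [PiLp.neg_apply, netInputVec_apply]
    rw [integral_neg, integral_netInput hε, dispatch_toReal_of_mem hn']
    exact neg_le_neg (le_arrival_share hμ₀ hμ hεμ (hc ▸ hm) hn')

variable (M) in
/-- State space collapse, with an exponent that depends on the primitives of the system only. -/
theorem exists_collapsesWith :
    ∃ θ > 0, ∀ r : ℝ → ℝ, Tendsto r (𝓝[>] 0) atTop → M.CollapsesWith r θ := by
  obtain ⟨μ₀, hμ₀, hμ⟩ := M.exists_minRate
  have hS : 0 < ∑ j, M.rate j := sum_rate_pos
  set δ := μ₀ ^ 2 / (2 * ∑ j, M.rate j) with hδ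
  have hδ0 : 0 < δ := by positivity
  set D : ℝ := N * (M.Amax + M.Smax) + 1 with hD
  have hD0 : 0 < D := by positivity
  -- The three bounds make `exp z ≤ 1 + z + z ^ 2` available for the exponents `z` in question, the
  -- quadratic term smaller than the linear one, and the drift factor nonnegative.
  set θ := min (1 / D) (min (δ / 4 / D ^ 2) (1 / δ)) with hθ
  have hθ0 : 0 < θ := by positivity
  have hθD : θ * D ≤ 1 := (le_div_iff₀ hD0).1 (min_le_left _ _)
  have hθδ : θ * D ^ 2 ≤ δ / 4 :=
    (le_div_iff₀ (by positivity)).1 ((min_le_right _ _).trans (min_le_left _ _))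
  have hθ1 : θ * δ ≤ 1 :=
    (le_div_iff₀ hδ0).1 ((min_le_right _ _).trans (min_le_right _ _))
  refine ⟨θ, hθ0, fun r hr => ?_⟩
  obtain ⟨ε₁, hε₁, h₁⟩ := mem_nhdsGT_iff_exists_Ioo_subset.1 (hr.eventually_ge_atTop 0)
  refine ⟨min ε₁ (μ₀ / 2), lt_min hε₁ (by positivity),
    (θ * δ / 4)⁻¹ * Real.exp (θ * (D ^ 2 / δ + D)), by positivity, fun ε hε hlt π hπ => ?_⟩
  have hr0 : 0 ≤ r ε := h₁ ⟨hε.1, hlt.trans_le (min_le_left _ _)⟩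
  have hc : 0 < θ * δ / 4 := by positivity
  have h1 := hπ.expect_le_of_drift hε (V := fun q => Real.exp (θ * distRegion (r ε) q))
    (f := fun q => θ * δ / 4 * Real.exp (θ * distRegion (r ε) q)) (g := fun _ => _)
    (fun q => by positivity) (fun q => by positivity) (fun _ => by positivity)
    (exp_distRegion_drift hε hμ₀ hμ (hlt.le.trans (min_le_right _ _)) hD0 (by simp [hD]) hθ0.le hθD
      hθδ hθ1 hr0)
  simp only [ENNReal.ofReal_mul hc.le] at h1
  rw [expect_const_mul, expect_const] at h1
  rw [ENNReal.ofReal_mul (by positivity), ENNReal.ofReal_inv_of_pos hc, mul_comm,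
    ← div_eq_mul_inv, ENNReal.le_div_iff_mul_le
      (Or.inl (by simpa using hc)) (Or.inl ENNReal.ofReal_ne_top), mul_comm]
  exact h1

end System

namespace System

/-! ### Unused service and the total queue length -/

/-- The total queue length. -/
def total {N : ℕ} (q : Fin N → ℕ) : ℝ := ∑ n, (q n : ℝ)

theorem total_nonneg {N : ℕ} (q : Fin N → ℕ) : 0 ≤ total q :=
  Finset.sum_nonneg fun _ _ => Nat.cast_nonneg _

theorem total_le_sum_sq {N : ℕ} (q : Fin N → ℕ) : total q ≤ ∑ n, (q n : ℝ) ^ 2 :=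
  Finset.sum_le_sum fun n _ => by exact_mod_cast Nat.le_self_pow two_ne_zero (q n)

theorem total_sq_le {N : ℕ} (q : Fin N → ℕ) : total q ^ 2 ≤ N * ∑ n, (q n : ℝ) ^ 2 := by
  simpa [total] using sq_sum_le_card_mul_sum_sq (s := Finset.univ) (f := fun n => (q n : ℝ))

/-- The total unused service of a slot: what truncation at zero adds to the queue lengths. -/
def unused {N : ℕ} (q : Fin N → ℕ) (ω : Outcome N) : ℝ :=
  ∑ n, ((after q ω n : ℝ) - q n - netInput ω n)

theorem total_after {N : ℕ} (q : Fin N → ℕ) (ω : Outcome N) :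
    total (after q ω) = total q + ∑ n, netInput ω n + unused q ω := by
  simp only [total, unused, Finset.sum_sub_distrib]
  ring

theorem unused_nonneg {N : ℕ} (q : Fin N → ℕ) (ω : Outcome N) : 0 ≤ unused q ω :=
  Finset.sum_nonneg fun n _ => by
    rw [after_apply]
    linarith [le_max_left ((q n : ℝ) + netInput ω n) 0]

theorem exists_after_eq_zero {N : ℕ} {q : Fin N → ℕ} {ω : Outcome N} (h : unused q ω ≠ 0) :
    ∃ n, after q ω n = 0 := by
  by_contra! hne
  refine h (Finset.sum_eq_zero fun n _ => ?_)
  have h1 : (after q ω n : ℝ) ≠ 0 := by exact_mod_cast hne n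
  rw [after_apply] at h1 ⊢
  rcases le_total ((q n : ℝ) + netInput ω n) 0 with h0 | h0
  · exact absurd (max_eq_right h0) h1
  · rw [max_eq_left h0]; ring

variable {N : ℕ} [NeZero N] {M : System N}
variable {ε : ℝ} (hε : ε ∈ Set.Ioo 0 M.εmax)

include hε in
theorem unused_le (r : ℝ) (q : Fin N → ℕ) :
    ∀ᵐ ω ∂M.noise ε r q, unused q ω ≤ N * M.Smax := by
  filter_upwards [ae_arrival_service hε r q] with ω hω
  have h : ∀ n, (after q ω n : ℝ) - q n - netInput ω n ≤ M.Smax := fun n => by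
    have h1 : (ω.2.2 n : ℝ) ≤ M.Smax := by exact_mod_cast hω.2 n
    have h2 : (0 : ℝ) ≤ if n = ω.1 then (ω.2.1 : ℝ) else 0 := by positivity
    have h3 : (0 : ℝ) ≤ q n := Nat.cast_nonneg _
    have h4 : (0 : ℝ) ≤ ω.2.2 n := Nat.cast_nonneg _
    rw [after_apply]
    rcases le_total ((q n : ℝ) + netInput ω n) 0 with h0 | h0
    · rw [max_eq_right h0]; unfold netInput; linarith
    · rw [max_eq_left h0]; linarith
  refine (Finset.sum_le_sum fun n _ => h n).trans ?_
  simp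

/-- At a state with an empty queue, the total queue length is controlled by the distance to the
region. Either the state is closer to the lower part, where every queue is at most `r`; or its
distance is at least `r`, which has exponentially small probability. -/
theorem total_le_of_eq_zero {N : ℕ} {r θ κ : ℝ} (hr : 0 ≤ r) (hθ : 0 ≤ θ) (hκ : 0 < κ)
    {x : Fin N → ℕ} {n : Fin N} (hn : x n = 0) :
    total x ≤ N * (r + distRegion r x) + (κ * total x ^ 2 +
      κ⁻¹ * Real.exp (-(θ * r)) * Real.exp (θ * distRegion r x)) := by
  have hmin := min_le_distRegion r x
  have hd := distRegion_nonneg r x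
  rcases le_total ‖excess r x‖ ‖deficit r x‖ with h | h
  · rw [min_eq_left h] at hmin
    have h1 : total x ≤ ∑ _n : Fin N, (r + distRegion r x) :=
      Finset.sum_le_sum fun m _ => by linarith [le_norm_excess r x m]
    have h2 : ∑ _n : Fin N, (r + distRegion r x) = N * (r + distRegion r x) := by
      simp only [Finset.sum_const, Finset.card_univ, Fintype.card_fin, nsmul_eq_mul]
    have h3 : 0 ≤ κ * total x ^ 2 +
      κ⁻¹ * Real.exp (-(θ * r)) * Real.exp (θ * distRegion r x) := by positivity
    linarith
  · rw [min_eq_right h] at hmin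
    have h1 : r ≤ distRegion r x := by
      have := le_norm_deficit r x n
      rw [hn, Nat.cast_zero, sub_zero] at this
      exact this.trans hmin
    have h2 : κ⁻¹ ≤ κ⁻¹ * Real.exp (-(θ * r)) * Real.exp (θ * distRegion r x) := by
      rw [mul_assoc, ← Real.exp_add]
      refine le_mul_of_one_le_right (by positivity) (Real.one_le_exp ?_)
      nlinarith
    have h3 : total x ≤ κ * total x ^ 2 + κ⁻¹ := by
      have h4 : κ * total x ^ 2 + κ⁻¹ - 2 * total x = κ * (total x - κ⁻¹) ^ 2 := by
        field_simp; ring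
      have h5 : 0 ≤ κ * (total x - κ⁻¹) ^ 2 := by positivity
      linarith [total_nonneg x]
    have h4 : 0 ≤ N * (r + distRegion r x) := by positivity
    linarith

/-- The cross term of total queue length and unused service. The parameters `κ` and `η` weight two
applications of Young's inequality. -/
theorem total_mul_unused_le {N : ℕ} {r θ κ η k : ℝ} (hr : 0 ≤ r) (hθ : 0 < θ) (hκ : 0 < κ)
    (hη : 0 < η) {q : Fin N → ℕ} {ω : Outcome N} (hk : unused q ω ≤ k) :
    total (after q ω) * unused q ω ≤ (N * r + N * k / η) * unused q ω +
      (2 * N * η / θ ^ 2 + k * (κ⁻¹ * Real.exp (-(θ * r)))) *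
        Real.exp (θ * distRegion r (after q ω)) + k * κ * total (after q ω) ^ 2 := by
  have hu := unused_nonneg q ω
  have hk0 : 0 ≤ k := hu.trans hk
  rcases eq_or_ne (unused q ω) 0 with h0 | h0
  · rw [h0]
    have : 0 ≤ (2 * N * η / θ ^ 2 + k * (κ⁻¹ * Real.exp (-(θ * r)))) *
        Real.exp (θ * distRegion r (after q ω)) + k * κ * total (after q ω) ^ 2 := by positivity
    linarith
  obtain ⟨n, hn⟩ := exists_after_eq_zero h0
  have h1 := total_le_of_eq_zero hr hθ.le hκ hn
  have hd := distRegion_nonneg r (after q ω)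
  generalize unused q ω = u at *
  generalize total (after q ω) = t at *
  generalize distRegion r (after q ω) = d at *
  set R := κ * t ^ 2 + κ⁻¹ * Real.exp (-(θ * r)) * Real.exp (θ * d) with hR
  have hR0 : 0 ≤ R := by positivity
  have hd2 : d ^ 2 ≤ 2 / θ ^ 2 * Real.exp (θ * d) := by
    have h2 := Real.quadratic_le_exp_of_nonneg (mul_nonneg hθ.le hd)
    rw [div_mul_eq_mul_div, le_div_iff₀ (by positivity)]
    nlinarith [mul_nonneg hθ.le hd]
  have hud : d * u ≤ k / η * u + η * d ^ 2 := by
    have h2 : u * u ≤ k * u := by gcongr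
    have h3 : u * u / η + η * d ^ 2 - 2 * (d * u) = (u - η * d) ^ 2 / η := by
      field_simp; ring
    have h4 : 0 ≤ (u - η * d) ^ 2 / η := by positivity
    have h5 : u * u / η ≤ k / η * u := by
      rw [div_mul_eq_mul_div]; gcongr
    have h6 : 0 ≤ d * u := by positivity
    linarith
  have hRu : R * u ≤ R * k := by gcongr
  calc t * u ≤ (N * (r + d) + R) * u := by gcongr
    _ = N * r * u + N * (d * u) + R * u := by ring
    _ ≤ N * r * u + N * (k / η * u + η * (2 / θ ^ 2 * Real.exp (θ * d))) + R * k := by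
      gcongr
      exact hud.trans (by gcongr)
    _ = _ := by rw [hR]; ring

/-! ### The heavy-traffic bound -/

include hε in
theorem integral_total_after (r : ℝ) (q : Fin N → ℕ) :
    ∫ ω, total (after q ω) ∂M.noise ε r q + ε =
      total q + ∫ ω, unused q ω ∂M.noise ε r q := by
  have hint := integrable_noise hε r q
  simp only [total_after]
  rw [integral_add (hint _) (hint _), integral_add (hint _) (hint _), integral_sum_netInput hε]
  simp only [integral_const, probReal_univ, one_smul]
  ring

include hε in
/-- The drift of the square of the total queue length; the terms after the second moment of the net
input bound the cross term of total queue length and unused service. -/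
theorem total_sq_drift {r θ κ η : ℝ} (hr : 0 ≤ r) (hθ : 0 < θ) (hκ : 0 < κ) (hη : 0 < η)
    (q : Fin N → ℕ) :
    ∫ ω, total (after q ω) ^ 2 ∂M.noise ε r q + 2 * ε * total q ≤ total q ^ 2 +
      ((var (M.arrival ε) + ∑ n, var (M.service n) + ε ^ 2) +
        2 * (N * r + N * (N * M.Smax) / η) * ∫ ω, unused q ω ∂M.noise ε r q +
        2 * (2 * N * η / θ ^ 2 + N * M.Smax * (κ⁻¹ * Real.exp (-(θ * r)))) *
          ∫ ω, Real.exp (θ * distRegion r (after q ω)) ∂M.noise ε r q +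
        2 * (N * M.Smax * κ) * ∫ ω, total (after q ω) ^ 2 ∂M.noise ε r q) := by
  have hint := integrable_noise hε r q
  rw [← integral_sum_netInput_sq hε r q]
  have h1 : ∫ ω, total (after q ω) ^ 2 ∂M.noise ε r q ≤
      ∫ ω, (total q ^ 2 + 2 * total q * ∑ n, netInput ω n + (∑ n, netInput ω n) ^ 2 +
        2 * (N * r + N * (N * M.Smax) / η) * unused q ω +
        2 * (2 * N * η / θ ^ 2 + N * M.Smax * (κ⁻¹ * Real.exp (-(θ * r)))) *
          Real.exp (θ * distRegion r (after q ω)) +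
        2 * (N * M.Smax * κ) * total (after q ω) ^ 2) ∂M.noise ε r q := by
    refine integral_mono_ae (hint _) (hint _) ?_
    filter_upwards [unused_le hε r q] with ω hω
    have h2 := total_mul_unused_le hr hθ hκ hη hω
    have h3 : total (after q ω) ^ 2 = total q ^ 2 + 2 * total q * ∑ n, netInput ω n +
        (∑ n, netInput ω n) ^ 2 + 2 * (total (after q ω) * unused q ω) - unused q ω ^ 2 := by
      rw [total_after]; ring
    linarith [sq_nonneg (unused q ω)]
  rw [integral_add (hint _) (hint _), integral_add (hint _) (hint _),
    integral_add (hint _) (hint _), integral_add (hint _) (hint _),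
    integral_add (hint _) (hint _)] at h1
  simp only [integral_const_mul] at h1
  rw [integral_sum_netInput hε] at h1
  simp only [integral_const, probReal_univ, one_smul] at h1
  linarith

variable {r : ℝ} {π : PMF (Fin N → ℕ)}

include hε in
theorem IsStationary.expect_integral_after (h : M.IsStationary ε r π) {F : (Fin N → ℕ) → ℝ}
    (hF : ∀ q, 0 ≤ F q) :
    expect π (fun q => ENNReal.ofReal (∫ ω, F (after q ω) ∂M.noise ε r q)) =
      expect π (fun q => ENNReal.ofReal (F q)) := by
  simp only [← expect_step_ofReal hε r _ hF]
  exact expect_of_invariant h _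

include hε in
/-- In steady state, the mean unused service is the gap `ε` between service and arrival rates. -/
theorem IsStationary.expect_unused (h : M.IsStationary ε r π)
    (hfin : expect π (fun q => ENNReal.ofReal (total q)) ≠ ∞) :
    expect π (fun q => ENNReal.ofReal (∫ ω, unused q ω ∂M.noise ε r q)) = ENNReal.ofReal ε := by
  have h1 : ∀ q, ENNReal.ofReal (∫ ω, total (after q ω) ∂M.noise ε r q) + ENNReal.ofReal ε =
      ENNReal.ofReal (total q) + ENNReal.ofReal (∫ ω, unused q ω ∂M.noise ε r q) := fun q => by
    rw [← ENNReal.ofReal_add (integral_nonneg fun _ => total_nonneg _) hε.1.le,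
      ← ENNReal.ofReal_add (total_nonneg q) (integral_nonneg fun _ => unused_nonneg _ _),
      integral_total_after hε]
  have h2 := congrArg (expect π) (funext h1)
  rw [expect_add, expect_add, h.expect_integral_after hε total_nonneg, expect_const] at h2
  exact ((ENNReal.add_right_inj hfin).1 h2).symm

theorem expect_ofReal_const_mul {X : Type*} (p : PMF X) {c : ℝ} (hc : 0 ≤ c) (f : X → ℝ) :
    expect p (fun x => ENNReal.ofReal (c * f x)) =
      ENNReal.ofReal c * expect p fun x => ENNReal.ofReal (f x) := by
  simp only [ENNReal.ofReal_mul hc]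
  exact expect_const_mul _ _ _

include hε in
/-- The quadratic drift inequality, averaged over the stationary distribution. -/
theorem IsStationary.mul_expect_total_le_of_drift (h : M.IsStationary ε r π) {θ v a b c C W : ℝ}
    (hv : 0 ≤ v) (ha : 0 ≤ a) (hb : 0 ≤ b) (hc : 0 ≤ c) (hC : 0 ≤ C) (hW : 0 ≤ W)
    (hcol : expect π (fun q => ENNReal.ofReal (Real.exp (θ * distRegion r q))) ≤ ENNReal.ofReal C)
    (hsq : expect π (fun q => ENNReal.ofReal (∑ n, (q n : ℝ) ^ 2)) ≤ ENNReal.ofReal W)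
    (hd : ∀ q, ∫ ω, total (after q ω) ^ 2 ∂M.noise ε r q + 2 * ε * total q ≤ total q ^ 2 +
      (v + 2 * a * ∫ ω, unused q ω ∂M.noise ε r q +
        2 * b * ∫ ω, Real.exp (θ * distRegion r (after q ω)) ∂M.noise ε r q +
        2 * c * ∫ ω, total (after q ω) ^ 2 ∂M.noise ε r q)) :
    ENNReal.ofReal ε * expect π (fun q => ENNReal.ofReal (total q)) ≤
      ENNReal.ofReal (v / 2 + a * ε + b * C + c * (N * W)) := by
  have hε0 := hε.1
  have htot : expect π (fun q => ENNReal.ofReal (total q)) ≠ ∞ :=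
    ne_top_of_le_ne_top ENNReal.ofReal_ne_top
      ((expect_mono π fun q => ENNReal.ofReal_le_ofReal (total_le_sum_sq q)).trans hsq)
  have hU := h.expect_unused hε htot
  have hsq' : expect π (fun q => ENNReal.ofReal (total q ^ 2)) ≤ ENNReal.ofReal (N * W) := by
    refine (expect_mono π fun q => ENNReal.ofReal_le_ofReal (total_sq_le q)).trans ?_
    rw [expect_ofReal_const_mul π (Nat.cast_nonneg N), ENNReal.ofReal_mul (Nat.cast_nonneg N)]
    gcongr
  have hu : ∀ q, 0 ≤ ∫ ω, unused q ω ∂M.noise ε r q := fun q =>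
    integral_nonneg fun _ => unused_nonneg _ _
  have he : ∀ q, 0 ≤ ∫ ω, Real.exp (θ * distRegion r (after q ω)) ∂M.noise ε r q := fun q =>
    integral_nonneg fun _ => (Real.exp_pos _).le
  have ht : ∀ q, 0 ≤ ∫ ω, total (after q ω) ^ 2 ∂M.noise ε r q := fun q =>
    integral_nonneg fun _ => sq_nonneg _
  have h1 := h.expect_le_of_drift hε (V := fun q => total q ^ 2) (f := fun q => 2 * ε * total q)
    (g := fun q => v + 2 * a * ∫ ω, unused q ω ∂M.noise ε r q +
      2 * b * ∫ ω, Real.exp (θ * distRegion r (after q ω)) ∂M.noise ε r q +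
      2 * c * ∫ ω, total (after q ω) ^ 2 ∂M.noise ε r q)
    (fun q => sq_nonneg _) (fun q => mul_nonneg (by positivity) (total_nonneg q))
    (fun q => by have := hu q; have := he q; have := ht q; positivity)
    hd
  have h2 : ∀ q, ENNReal.ofReal (v + 2 * a * ∫ ω, unused q ω ∂M.noise ε r q +
      2 * b * ∫ ω, Real.exp (θ * distRegion r (after q ω)) ∂M.noise ε r q +
      2 * c * ∫ ω, total (after q ω) ^ 2 ∂M.noise ε r q) = ENNReal.ofReal v +
        ENNReal.ofReal (2 * a * ∫ ω, unused q ω ∂M.noise ε r q) +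
        ENNReal.ofReal (2 * b * ∫ ω, Real.exp (θ * distRegion r (after q ω)) ∂M.noise ε r q) +
        ENNReal.ofReal (2 * c * ∫ ω, total (after q ω) ^ 2 ∂M.noise ε r q) := fun q => by
    have := hu q; have := he q; have := ht q
    rw [ENNReal.ofReal_add (by positivity) (by positivity),
      ENNReal.ofReal_add (by positivity) (by positivity),
      ENNReal.ofReal_add (by positivity) (by positivity)]
  simp only [h2] at h1
  rw [expect_add, expect_add, expect_add, expect_const,
    expect_ofReal_const_mul π (by positivity), expect_ofReal_const_mul π (by positivity),
    expect_ofReal_const_mul π (by positivity), expect_ofReal_const_mul π (by positivity), hU,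
    h.expect_integral_after hε (F := fun x => Real.exp (θ * distRegion r x))
      fun _ => (Real.exp_pos _).le,
    h.expect_integral_after hε (F := fun x => total x ^ 2) fun _ => sq_nonneg _] at h1
  have h3 : ENNReal.ofReal (2 * ε) * expect π (fun q => ENNReal.ofReal (total q)) ≤
      ENNReal.ofReal (v + 2 * a * ε + 2 * b * C + 2 * c * (N * W)) := by
    refine h1.trans ?_
    rw [ENNReal.ofReal_add (by positivity) (by positivity),
      ENNReal.ofReal_add (by positivity) (by positivity),
      ENNReal.ofReal_add (by positivity) (by positivity), ENNReal.ofReal_mul (q := ε) (by positivity),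
      ENNReal.ofReal_mul (q := C) (by positivity), ENNReal.ofReal_mul (q := N * W) (by positivity)]
    gcongr
  calc ENNReal.ofReal ε * expect π (fun q => ENNReal.ofReal (total q))
      = ENNReal.ofReal (1 / 2) * (ENNReal.ofReal (2 * ε) *
          expect π (fun q => ENNReal.ofReal (total q))) := by
        rw [← mul_assoc, ← ENNReal.ofReal_mul (by norm_num)]
        congr 2; ring
    _ ≤ ENNReal.ofReal (1 / 2) * ENNReal.ofReal (v + 2 * a * ε + 2 * b * C + 2 * c * (N * W)) := by
        gcongr
    _ = _ := by
        rw [← ENNReal.ofReal_mul (by norm_num)]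
        congr 1; ring

include hε in
theorem IsStationary.mul_expect_total_le (h : M.IsStationary ε r π) {θ κ η C W : ℝ} (hr : 0 ≤ r)
    (hθ : 0 < θ) (hκ : 0 < κ) (hη : 0 < η) (hC : 0 ≤ C) (hW : 0 ≤ W)
    (hcol : expect π (fun q => ENNReal.ofReal (Real.exp (θ * distRegion r q))) ≤ ENNReal.ofReal C)
    (hsq : expect π (fun q => ENNReal.ofReal (∑ n, (q n : ℝ) ^ 2)) ≤ ENNReal.ofReal W) :
    ENNReal.ofReal ε * expect π (fun q => ENNReal.ofReal (total q)) ≤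
      ENNReal.ofReal ((var (M.arrival ε) + ∑ n, var (M.service n) + ε ^ 2) / 2 +
        (N * r + N * (N * M.Smax) / η) * ε +
        (2 * N * η / θ ^ 2 + N * M.Smax * (κ⁻¹ * Real.exp (-(θ * r)))) * C +
        N * M.Smax * κ * (N * W)) := by
  have h1 : 0 ≤ var (M.arrival ε) := variance_nonneg _ _
  have h2 : 0 ≤ ∑ n, var (M.service n) := Finset.sum_nonneg fun n _ => variance_nonneg _ _
  have hv : 0 ≤ var (M.arrival ε) + ∑ n, var (M.service n) + ε ^ 2 :=
    add_nonneg (add_nonneg h1 h2) (sq_nonneg ε)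
  have ha : 0 ≤ N * r + N * (N * M.Smax) / η := by positivity
  have hb : 0 ≤ 2 * N * η / θ ^ 2 + N * M.Smax * (κ⁻¹ * Real.exp (-(θ * r))) := by positivity
  have hc : 0 ≤ N * M.Smax * κ := by positivity
  exact h.mul_expect_total_le_of_drift hε hv ha hb hc hC hW hcol hsq
    (total_sq_drift hε hr hθ hκ hη)

/-! ### The heavy-traffic limit -/

section Limit

variable {r : ℝ → ℝ} {θ α : ℝ}

theorem tendsto_log_inv : Tendsto (fun ε : ℝ => Real.log (1 / ε)) (𝓝[>] 0) atTop := by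
  simp only [one_div]
  exact Real.tendsto_log_atTop.comp tendsto_inv_nhdsGT_zero

theorem tendsto_threshold (hθ : 0 < θ) (hα : 0 < α)
    (hr : ∀ᶠ ε in 𝓝[>] 0, 2 * (1 + α) / θ * Real.log (1 / ε) ≤ r ε) :
    Tendsto r (𝓝[>] 0) atTop :=
  tendsto_atTop_mono' _ hr (tendsto_log_inv.const_mul_atTop (by positivity))

theorem tendsto_exp_div (hθ : 0 < θ) (hα : 0 < α)
    (hr : ∀ᶠ ε in 𝓝[>] 0, 2 * (1 + α) / θ * Real.log (1 / ε) ≤ r ε) :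
    Tendsto (fun ε => Real.exp (-(θ * r ε / 2)) / ε) (𝓝[>] 0) (𝓝 0) := by
  have h1 : Tendsto (fun ε : ℝ => Real.exp (-(α * Real.log (1 / ε)))) (𝓝[>] 0) (𝓝 0) :=
    Real.tendsto_exp_neg_atTop_nhds_zero.comp (tendsto_log_inv.const_mul_atTop hα)
  refine tendsto_of_tendsto_of_tendsto_of_le_of_le' tendsto_const_nhds h1 ?_ ?_
  · filter_upwards [self_mem_nhdsWithin] with ε hε
    have : 0 < ε := hε
    positivity
  · filter_upwards [self_mem_nhdsWithin, hr] with ε hε h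
    have hε0 : 0 < ε := hε
    rw [div_le_iff₀ hε0]
    nth_rw 3 [← Real.exp_log hε0]
    rw [← Real.exp_add, Real.exp_le_exp]
    rw [one_div, Real.log_inv, div_mul_eq_mul_div, div_le_iff₀ hθ] at h
    rw [one_div, Real.log_inv]
    linarith

theorem tendsto_sq_mul_exp (hθ : 0 < θ) (hr : Tendsto r (𝓝[>] 0) atTop) :
    Tendsto (fun ε => r ε ^ 2 * Real.exp (-(θ * r ε / 2))) (𝓝[>] 0) (𝓝 0) := by
  have h1 := ((Real.tendsto_pow_mul_exp_neg_atTop_nhds_zero 2).comp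
    (hr.const_mul_atTop (half_pos hθ))).const_mul ((2 / θ) ^ 2)
  rw [mul_zero] at h1
  refine h1.congr fun ε => ?_
  simp only [Function.comp_apply]
  rw [show θ / 2 * r ε = θ * r ε / 2 by ring]
  field_simp

/-- The limit of the bound on `ε * E[∑ Q n]`, with `κ = ε * exp (-θ r / 2)` and `η = √ε`. -/
theorem tendsto_heavyTraffic_bound {v : ℝ → ℝ} {v₀ A k C c S B : ℝ} (hθ : 0 < θ) (hα : 0 < α)
    (hc : c ≠ 0) (hv : Tendsto v (𝓝[>] 0) (𝓝 v₀))
    (hr : ∀ᶠ ε in 𝓝[>] 0, 2 * (1 + α) / θ * Real.log (1 / ε) ≤ r ε)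
    (hro : r =o[𝓝[>] 0] (fun ε => 1 / ε)) :
    Tendsto (fun ε => (v ε + ε ^ 2) / 2 + (A * r ε + A * k / √ε) * ε +
      (2 * A * √ε / θ ^ 2 +
        k * ((ε * Real.exp (-(θ * r ε / 2)))⁻¹ * Real.exp (-(θ * r ε)))) * C +
      k * (ε * Real.exp (-(θ * r ε / 2))) * (A * ((2 * ε * c)⁻¹ *
        (3 * r ε ^ 2 * S + A * (9 * B ^ 4 / (4 * (ε * c)) + B ^ 3))))) (𝓝[>] 0)
      (𝓝 (v₀ / 2)) := by
  have hid : Tendsto (fun ε : ℝ => ε) (𝓝[>] 0) (𝓝 0) := nhdsWithin_le_nhds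
  have hsqrt : Tendsto (fun ε : ℝ => √ε) (𝓝[>] 0) (𝓝 0) := by
    simpa using (Real.continuous_sqrt.tendsto 0).mono_left nhdsWithin_le_nhds
  have hrε : Tendsto (fun ε => r ε * ε) (𝓝[>] 0) (𝓝 0) := by
    simpa [div_eq_mul_inv] using hro.tendsto_div_nhds_zero
  have hE := tendsto_exp_div hθ hα hr
  have hrE := tendsto_sq_mul_exp hθ (tendsto_threshold hθ hα hr)
  have hlim := ((((hv.add (hid.pow 2)).div_const 2).add
    ((hrε.const_mul A).add (hsqrt.const_mul (A * k)))).add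
    (((hsqrt.const_mul (2 * A / θ ^ 2)).add (hE.const_mul k)).mul_const C)).add
    ((((hrE.const_mul (3 * S)).add (hE.const_mul (A * (9 * B ^ 4 / (4 * c))))).add
      ((hE.mul hid).const_mul (A * B ^ 3))).const_mul (k * A * (2 * c)⁻¹))
  simp only [ne_eq, OfNat.ofNat_ne_zero, not_false_eq_true, zero_pow, mul_zero, add_zero,
    zero_mul] at hlim
  refine hlim.congr' ?_
  filter_upwards [self_mem_nhdsWithin] with ε hε
  have hε0 : 0 < ε := hε
  have hexp : Real.exp (-(θ * r ε)) = Real.exp (-(θ * r ε / 2)) * Real.exp (-(θ * r ε / 2)) := by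
    rw [← Real.exp_add]; ring_nf
  have hEp := Real.exp_pos (-(θ * r ε / 2))
  rw [hexp]
  generalize Real.exp (-(θ * r ε / 2)) = E at *
  have hsε : A * k / √ε * ε = A * k * √ε := by
    rw [div_mul_eq_mul_div, mul_div_assoc, Real.div_sqrt]
  rw [add_mul (A * r ε), hsε]
  field_simp
  ring

end Limit

theorem heavyTrafficDelayOptimal {σsq : ℝ}
    (hσ : Tendsto (fun ε => var (M.arrival ε)) (𝓝[>] 0) (𝓝 σsq)) {r : ℝ → ℝ} {θ α : ℝ}
    (hθ : 0 < θ) (hα : 0 < α) (hcol : M.CollapsesWith r θ)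
    (hr : ∀ᶠ ε in 𝓝[>] 0, 2 * (1 + α) / θ * Real.log (1 / ε) ≤ r ε)
    (hro : r =o[𝓝[>] 0] (fun ε => 1 / ε)) :
    M.HeavyTrafficDelayOptimal σsq r := by
  refine ⟨fun ε hε => existsUnique_isStationary hε (r ε), fun π hπ => ?_⟩
  obtain ⟨ε₀, hε₀, C, hC, hcol⟩ := hcol
  obtain ⟨μ₀, hμ₀, hμ⟩ := M.exists_minRate
  have hS : 0 < ∑ m, M.rate m := sum_rate_pos
  have hc : 0 < μ₀ / ∑ m, M.rate m := by positivity
  have hlim := tendsto_heavyTraffic_bound (A := N) (k := N * M.Smax) (C := C)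
    (S := ∑ m, M.rate m) (B := M.Amax + M.Smax) hθ hα hc.ne'
    (hσ.add_const (∑ n, var (M.service n))) hr hro
  rw [← (ENNReal.tendsto_ofReal hlim).limsup_eq]
  refine limsup_le_limsup ?_
  filter_upwards [Ioo_mem_nhdsGT M.εmax_pos, Ioo_mem_nhdsGT hε₀,
    (tendsto_threshold hθ hα hr).eventually_ge_atTop 0] with ε hε hlt hr0
  have hε0 := hε.1
  have hsum : ∀ q : Fin N → ℕ, ∑ n, (q n : ℝ≥0∞) = ENNReal.ofReal (total q) := fun q => by
    rw [total, ENNReal.ofReal_sum_of_nonneg fun _ _ => Nat.cast_nonneg _]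
    simp
  simp only [hsum]
  -- These weights balance the second moment, of order `1 / ε ^ 2`, against the tail probability,
  -- of order `exp (-θ r)`, and the mean `ε` of the unused service against the distance.
  exact (hπ ε hε).mul_expect_total_le hε hr0 hθ (κ := ε * Real.exp (-(θ * r ε / 2))) (η := √ε)
    (by positivity) (by positivity) hC.le (by positivity) (hcol ε hε hlt.2 _ (hπ ε hε))
    ((hπ ε hε).expect_sum_sq_le hε hμ₀ hμ)

end System

end JBT

theorem theorem2 {N : ℕ} [NeZero N] (M : JBT.System N) (σsq : ℝ)
    (hσ : Tendsto (fun ε => JBT.var (M.arrival ε)) (𝓝[>] 0) (𝓝 σsq)) :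
    (∀ r : ℝ, ∀ ε ∈ Set.Ioo 0 M.εmax, ∃! π, M.IsStationary ε r π) ∧
    (∃ θ > 0, ∀ r : ℝ → ℝ, Tendsto r (𝓝[>] 0) atTop → M.CollapsesWith r θ) ∧
    (∀ (r : ℝ → ℝ) (θ α : ℝ), 0 < θ → 0 < α → M.CollapsesWith r θ →
      (∀ᶠ ε in 𝓝[>] 0, 2 * (1 + α) / θ * Real.log (1 / ε) ≤ r ε) →
      r =o[𝓝[>] 0] (fun ε => 1 / ε) →
      M.HeavyTrafficDelayOptimal σsq r) :=
  ⟨fun r _ hε => JBT.System.existsUnique_isStationary hε r, M.exists_collapsesWith,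
    fun _ _ _ hθ hα hcol hr hro => JBT.System.heavyTrafficDelayOptimal hσ hθ hα hcol hr hro⟩
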